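/- Let $V$ be an infinite set and let $\{B_v\}_{v\in V}$ be pairwise disjoint open disks of radius $\tfrac12$ in $\mathbb R^2$ with centers $c_v$. Let $(V,E)$ be their contact graph, in which $v\sim w$ if and only if the boundary circles of $B_v$ and $B_w$ are tangent, i.e. $|c_v-c_w|=1$, and assume that $(V,E)$ is connected. Embed $(V,E)$ in $\mathbb R^2$ by $v\mapsto c_v$ and by drawing each edge $\{v,w\}$ as the segment $\overline{c_vc_w}$; the faces are the connected components of the complement of the image, and the degree $\deg(\sigma)\in\mathbb N\cup\{\infty\}$ of a face $\sigma$ is the number of its corners, a corner of $\sigma$ at a vertex $v$ being a sector (a connected component of $B_v$ minus the embedded graph) that is contained in $\sigma$. (So corners of angle $\pi$ count, and a vertex may contribute several corners to one face.) Write $B_R(x)=\{y\in V: d(y,x)\le R\}$ for the balls of the combinatorial distance $d$ and $|\cdot|$ for the number of vertices. For every $D\in\mathbb N$ there are constants $C_1,C_2>0$ depending only on $D$ such that for every such infinite connected penny graph $G=(V,E,F)$ with $\deg(\sigma)\le D$ for all faces $\sigma\in F$, all balls are finite and the following hold. (1) Volume doubling: $|B_{2R}(x)|\le C_1|B_R(x)|$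 for all $x\in V$ and all real $R>0$. (2) Poincaré inequality: for all $x\in V$, all real $R>0$ and all $f:B_{2R}(x)\to\mathbb R$, $$\sum_{y\in B_R(x)}|f(y)-\overline f|^2\le C_2R^2\sum_{\substack{y,z\in B_{2R}(x)\\ y\sim z}}|f(y)-f(z)|^2,\qquad \overline f=\frac1{|B_R(x)|}\sum_{y\in B_R(x)}f(y).$$ -/

import Mathlib

/-- The Euclidean plane. -/
abbrev Plane : Type := EuclideanSpace ℝ (Fin 2)

/-- The connected components of a subset `A` of a topological space, as a set of subsets. -/
def componentsOf {X : Type*} [TopologicalSpace X] (A : Set X) : Set (Set X) :=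
  {K | ∃ p ∈ A, K = connectedComponentIn A p}

/-- A configuration of pennies indexed by `V`: pairwise disjoint open disks of radius `1/2` in the
plane, given by their centers. -/
structure PennyConfiguration (V : Type*) where
  center : V → Plane
  disjoint_disks : ∀ v w : V, v ≠ w →
    Disjoint (Metric.ball (center v) (1 / 2)) (Metric.ball (center w) (1 / 2))

namespace PennyConfiguration

variable {V : Type*} (P : PennyConfiguration V)

/-- The open disk of the penny `v`. -/
def disk (v : V) : Set Plane := Metric.ball (P.center v) (1 / 2)

/-- The contact graph: two pennies are adjacent iff their boundary circles (of radius `1/2`, with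
disjoint open disks) are tangent, i.e. iff their centers are at distance `1`. -/
def graph : SimpleGraph V where
  Adj v w := dist (P.center v) (P.center w) = 1
  symm := ⟨fun v w h => by rw [dist_comm]; exact h⟩
  loopless := ⟨fun v h => by simp at h⟩

/-- The image of the geometric embedding of the contact graph: all centers, and for each edge the
segment that joins the two centers. -/
def skeleton : Set Plane :=
  Set.range P.center ∪
    {p | ∃ v w : V, P.graph.Adj v w ∧ p ∈ segment ℝ (P.center v) (P.center w)}

/-- The faces: connected components of the complement of the embedded graph. -/
def faces : Set (Set Plane) := componentsOf P.skeletonᶜ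

/-- The corners (interior angles) of a face `σ`. In the open disk of the penny `v` the embedded
graph consists of the radii along the edges at `v`, which cut the disk into open sectors (a slit
disk, of angle `2π`, if `v` has one neighbour). A corner of `σ` at `v` is such a sector that lies
in `σ`; a vertex that the boundary of `σ` visits several times has several corners in `σ`, and
a corner may have angle `π`. -/
def corners (σ : Set Plane) : Set (V × Set Plane) :=
  {c | c.2 ∈ componentsOf (P.disk c.1 \ P.skeleton) ∧ c.2 ⊆ σ}

/-- The facial degree: the number of corners, in `ℕ ∪ {∞}`. -/
noncomputable def facialDegree (σ : Set Plane) : ℕ∞ := (P.corners σ).encard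

end PennyConfiguration

namespace SimpleGraph

variable {V : Type*} (G : SimpleGraph V)

/-- The ball `B_R(x)` of the combinatorial distance (infinite between different components). -/
def metricBall (x : V) (R : ℝ) : Set V := {y | G.Reachable y x ∧ (G.dist y x : ℝ) ≤ R}

/-- The volume doubling property with constant `C`, for the counting measure. Finiteness of the
balls is part of the property, so that `Set.ncard` is the number of vertices. -/
def VolumeDoublingWith (C : ℝ) : Prop :=
  ∀ (x : V) (R : ℝ), 0 < R →
    (G.metricBall x (2 * R)).Finite ∧
    ((G.metricBall x (2 * R)).ncard : ℝ) ≤ C * ((G.metricBall x R).ncard : ℝ)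

/-- The mean value of `f` over `B_R(x)`. -/
noncomputable def ballMean (x : V) (R : ℝ) (f : V → ℝ) : ℝ :=
  (∑ᶠ y ∈ G.metricBall x R, f y) / ((G.metricBall x R).ncard : ℝ)

/-- The ordered pairs of adjacent vertices in `B_R(x)`. -/
def ballEdges (x : V) (R : ℝ) : Set (V × V) :=
  {p | p.1 ∈ G.metricBall x R ∧ p.2 ∈ G.metricBall x R ∧ G.Adj p.1 p.2}

/-- The (2-)Poincaré inequality with constant `C`. Only the values of `f` on `B_{2R}(x)` matter.
Finiteness of the balls is part of the property, so that all sums are finite sums. -/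
def PoincareWith (C : ℝ) : Prop :=
  ∀ (x : V) (R : ℝ), 0 < R →
    (G.metricBall x (2 * R)).Finite ∧
    ∀ f : V → ℝ,
      ∑ᶠ y ∈ G.metricBall x R, |f y - G.ballMean x R f| ^ 2 ≤
        C * R ^ 2 * ∑ᶠ p ∈ G.ballEdges x (2 * R), |f p.1 - f p.2| ^ 2

end SimpleGraph

/-!
A penny graph with faces of bounded degree is roughly isometric to the lattice `ℤ²`.

The boundary walk of a face on the left of a dart is the orbit `O` of that dart under `facePred`.
The total angle under which `O` is seen from a point `p` is `2π` times a winding number: it is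
constant as `p` moves in a face, it jumps by `2π` across every dart of `O`, and it vanishes far away
from `O`. In a connected graph this determines it: it is `2π` on the left of the darts of `O` and
`0` on the left of all others. Hence all corners of a face lie on one orbit, and every point of the
face is close to it. A bound on the degrees therefore bounds both the diameter of a face in the
plane and the graph distance between two of its corners. The vertices around the lattice points
then provide a Lipschitz map from `ℤ²` to the graph, which inverts the embedding `v ↦ c_v` up to
bounded errors, as two vertices around nearby points are joined by a short chain of faces.

Volumes are quadratic by packing, which gives doubling. The sum of the squared differences of a
function over a square of `ℤ²` is at most a multiple of its energy there, and the Lipschitz maps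
carry this over to a weak Poincaré inequality in which the ball on the right is larger by a constant
factor. Applied to balls whose radius is a small multiple of `R`, it compares the averages of `f`
over overlapping balls; chaining these averages from a point of `B_R(x)` to `x` leads to the
Poincaré inequality with `B_{2R}(x)` on the right.
-/

/-! ### Separated families of points -/

/-- A family of points with mutual distances at least `1`. -/
def UnitSeparated {V E : Type*} [PseudoMetricSpace E] (c : V → E) : Prop :=
  Pairwise fun v w => 1 ≤ dist (c v) (c w)

namespace UnitSeparated

open MeasureTheory Metric

theorem injective {V E : Type*} [PseudoMetricSpace E] {c : V → E} (hc : UnitSeparated c) :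
    Function.Injective c := by
  intro v w h
  by_contra hvw
  have hle : 1 ≤ dist (c v) (c w) := hc hvw
  rw [h, dist_self] at hle
  exact one_pos.not_ge hle

variable {V E : Type*} [NormedAddCommGroup E] [NormedSpace ℝ E] [FiniteDimensional ℝ E]
  {c : V → E}

theorem card_le (hc : UnitSeparated c) (z : E) {r : ℝ} (hr : 0 ≤ r) (s : Finset V)
    (hs : ∀ v ∈ s, dist (c v) z ≤ r) :
    (s.card : ℝ) ≤ (2 * r + 1) ^ Module.finrank ℝ E := by
  let _ : MeasurableSpace E := borel E
  have : BorelSpace E := ⟨rfl⟩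
  let μ : Measure E := Measure.addHaar
  have hdisj : Set.PairwiseDisjoint (s : Set V) fun v => ball (c v) (1 / 2) :=
    fun v _ w _ hvw => ball_disjoint_ball (by linarith [hc hvw])
  have hsub : ⋃ v ∈ s, ball (c v) (1 / 2) ⊆ ball z (r + 1 / 2) :=
    Set.iUnion₂_subset fun v hv => ball_subset_ball' (by linarith [hs v hv])
  have hμ : (s.card : ENNReal) * (ENNReal.ofReal ((1 / 2) ^ Module.finrank ℝ E) * μ (ball 0 1)) ≤
      ENNReal.ofReal ((r + 1 / 2) ^ Module.finrank ℝ E) * μ (ball 0 1) := calc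
    _ = ∑ v ∈ s, μ (ball (c v) (1 / 2)) := by
      simp only [Measure.addHaar_ball_of_pos μ _ (one_half_pos (α := ℝ)), Finset.sum_const,
        nsmul_eq_mul]
    _ = μ (⋃ v ∈ s, ball (c v) (1 / 2)) :=
      (measure_biUnion_finset hdisj fun _ _ => measurableSet_ball).symm
    _ ≤ μ (ball z (r + 1 / 2)) := measure_mono hsub
    _ = _ := Measure.addHaar_ball_of_pos μ _ (by linarith)
  rw [← mul_assoc, ENNReal.mul_le_mul_iff_left (measure_ball_pos μ _ one_pos).ne'
    measure_ball_lt_top.ne, ← ENNReal.ofReal_natCast, ← ENNReal.ofReal_mul (by positivity),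
    ENNReal.ofReal_le_ofReal_iff (by positivity)] at hμ
  calc (s.card : ℝ) = s.card * (1 / 2) ^ Module.finrank ℝ E * 2 ^ Module.finrank ℝ E := by
        rw [mul_assoc, ← mul_pow]
        norm_num
    _ ≤ (r + 1 / 2) ^ Module.finrank ℝ E * 2 ^ Module.finrank ℝ E := by gcongr
    _ = (2 * r + 1) ^ Module.finrank ℝ E := by
        rw [← mul_pow]
        ring_nf

theorem finite_closedBall (hc : UnitSeparated c) (z : E) (r : ℝ) :
    {v | dist (c v) z ≤ r}.Finite := by
  by_contra hinf
  obtain ⟨n, hn⟩ := exists_nat_gt ((2 * r + 1) ^ Module.finrank ℝ E)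
  obtain ⟨s, hs, rfl⟩ := Set.Infinite.exists_subset_card_eq hinf n
  obtain rfl | ⟨v, hv⟩ := s.eq_empty_or_nonempty
  · obtain ⟨v, hv⟩ := Set.Infinite.nonempty hinf
    have : (0 : ℝ) ≤ (2 * r + 1) ^ Module.finrank ℝ E :=
      pow_nonneg (by linarith [dist_nonneg.trans (Set.mem_ofPred.1 hv)]) _
    simp only [Finset.card_empty, Nat.cast_zero] at hn
    linarith
  · exact hn.not_ge (hc.card_le z (dist_nonneg.trans (hs hv)) s fun w hw => hs hw)

end UnitSeparated

/-! ### Counterclockwise angles -/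

section Angle

open Real

/-- The angle in `(0, 2π]` by which `1` is turned counterclockwise into the direction of `u`. The
value at `u = 1` is `2π`: a dart that is alone at its vertex is followed by itself after a full
turn. -/
noncomputable def ccwAngle (u : ℂ) : ℝ := toIocMod two_pi_pos 0 (Complex.arg u)

theorem ccwAngle_pos (u : ℂ) : 0 < ccwAngle u := left_lt_toIocMod _ _ _

theorem ccwAngle_le (u : ℂ) : ccwAngle u ≤ 2 * π :=
  (toIocMod_le_right two_pi_pos 0 (Complex.arg u)).trans_eq (zero_add _)

theorem exp_ccwAngle {u : ℂ} (hu : ‖u‖ = 1) : Complex.exp (ccwAngle u * Complex.I) = u := by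
  have hturn : ccwAngle u = Complex.arg u - toIocDiv two_pi_pos 0 (Complex.arg u) * (2 * π) := by
    rw [ccwAngle, ← self_sub_toIocDiv_zsmul, zsmul_eq_mul]
  calc Complex.exp (ccwAngle u * Complex.I)
      = Complex.exp (Complex.arg u * Complex.I -
          toIocDiv two_pi_pos 0 (Complex.arg u) * (2 * π * Complex.I)) := by
        rw [hturn]
        push_cast
        ring_nf
    _ = u := by
        rw [Complex.exp_sub, Complex.exp_int_mul_two_pi_mul_I, div_one]
        simpa [hu] using Complex.norm_mul_exp_arg_mul_I u

theorem ccwAngle_exp {t : ℝ} (h0 : 0 < t) (h1 : t ≤ 2 * π) :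
    ccwAngle (Complex.exp (t * Complex.I)) = t := by
  rw [ccwAngle, Complex.arg_exp_mul_I, toIocMod_toIocMod, toIocMod_eq_self]
  simpa using And.intro h0 h1

theorem ccwAngle_injOn : Set.InjOn ccwAngle {u | ‖u‖ = 1} := fun u hu w hw h => by
  rw [← exp_ccwAngle hu, h, exp_ccwAngle hw]

theorem ccwAngle_div {u w : ℂ} (hu : ‖u‖ = 1) (hw : ‖w‖ = 1) (h : ccwAngle u < ccwAngle w) :
    ccwAngle (w / u) = ccwAngle w - ccwAngle u := by
  nth_rewrite 1 [← exp_ccwAngle hu, ← exp_ccwAngle hw]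
  rw [← Complex.exp_sub, ← sub_mul, ← Complex.ofReal_sub]
  exact ccwAngle_exp (sub_pos.2 h) (by linarith [ccwAngle_pos u, ccwAngle_le w])

end Angle

/-! ### Penny configurations in the complex plane -/

theorem norm_smul_add_smul_sq {E : Type*} [NormedAddCommGroup E] [InnerProductSpace ℝ E]
    {s t : ℝ} (hst : s + t = 1) (u v : E) :
    ‖s • u + t • v‖ ^ 2 = s * ‖u‖ ^ 2 + t * ‖v‖ ^ 2 - s * t * ‖u - v‖ ^ 2 := by
  obtain rfl : s = 1 - t := by linarith
  rw [norm_add_sq_real, norm_sub_sq_real, norm_smul, norm_smul, mul_pow, mul_pow, Real.norm_eq_abs,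
    Real.norm_eq_abs, sq_abs, sq_abs, real_inner_smul_left, real_inner_smul_right]
  ring

/-- An isometry from the Euclidean plane to the complex plane, where arguments are available. -/
noncomputable def planeEquiv : Plane ≃ₗᵢ[ℝ] ℂ := Complex.orthonormalBasisOneI.repr.symm

namespace PennyConfiguration

variable {V : Type*} (P : PennyConfiguration V)

/-- The center of a penny as a complex number. -/
noncomputable def pos (v : V) : ℂ := planeEquiv (P.center v)

/-- The union of the edges of the contact graph in the complex plane. Isolated vertices are left
out, unlike in `skeleton`. -/
def net : Set ℂ := {p | ∃ v w : V, P.graph.Adj v w ∧ p ∈ segment ℝ (P.pos v) (P.pos w)}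

theorem dist_pos (v w : V) : dist (P.pos v) (P.pos w) = dist (P.center v) (P.center w) :=
  planeEquiv.dist_map _ _

theorem norm_of_adj {v w : V} (h : P.graph.Adj v w) : ‖P.pos w - P.pos v‖ = 1 := by
  rw [← dist_eq_norm, dist_pos]
  exact h.symm

theorem unitSeparated_pos : UnitSeparated P.pos := by
  intro v w hvw
  have h := (disjoint_ball_ball_iff (by norm_num) (by norm_num)).1 (P.disjoint_disks v w hvw)
  rw [dist_pos]
  linarith

theorem one_le_norm_pos_sub {v w : V} (h : v ≠ w) : 1 ≤ ‖P.pos v - P.pos w‖ := by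
  rw [← dist_eq_norm]
  exact P.unitSeparated_pos h

theorem card_le {s : Finset V} {z : ℂ} {r : ℝ} (hr : 0 ≤ r) (hs : ∀ v ∈ s, ‖P.pos v - z‖ ≤ r) :
    (s.card : ℝ) ≤ (2 * r + 1) ^ 2 := by
  simpa only [Complex.finrank_real_complex, dist_eq_norm] using
    P.unitSeparated_pos.card_le z hr s fun v hv => (dist_eq_norm _ _).trans_le (hs v hv)

theorem finite_norm_pos_sub_le (z : ℂ) (r : ℝ) : {v | ‖P.pos v - z‖ ≤ r}.Finite := by
  simpa only [dist_eq_norm] using P.unitSeparated_pos.finite_closedBall z r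

theorem mem_closedBall_of_mem_segment {v w : V} {p : ℂ} (h : P.graph.Adj v w)
    (hp : p ∈ segment ℝ (P.pos v) (P.pos w)) : p ∈ Metric.closedBall (P.pos v) 1 :=
  (convex_closedBall _ _).segment_subset (Metric.mem_closedBall_self zero_le_one)
    (mem_closedBall_iff_norm.2 (P.norm_of_adj h).le) hp

theorem eq_or_eq_of_mem_segment {a v w : V} {p : ℂ} (h : P.graph.Adj v w)
    (hp : p ∈ segment ℝ (P.pos v) (P.pos w)) (hpa : ‖p - P.pos a‖ < 3 / 4) : a = v ∨ a = w := by
  by_contra! hne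
  obtain ⟨s, t, hs, ht, hst, rfl⟩ := hp
  have hstewart := norm_smul_add_smul_sq hst (P.pos v - P.pos a) (P.pos w - P.pos a)
  have hcomb : s • (P.pos v - P.pos a) + t • (P.pos w - P.pos a) =
      s • P.pos v + t • P.pos w - P.pos a := by
    rw [smul_sub, smul_sub, sub_add_sub_comm, ← add_smul, hst, one_smul]
  rw [hcomb, sub_sub_sub_cancel_right, P.norm_of_adj h.symm] at hstewart
  have hv : 1 ≤ ‖P.pos v - P.pos a‖ ^ 2 := one_le_pow₀ (P.one_le_norm_pos_sub hne.1.symm)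
  have hw : 1 ≤ ‖P.pos w - P.pos a‖ ^ 2 := one_le_pow₀ (P.one_le_norm_pos_sub hne.2.symm)
  have hlt := pow_lt_pow_left₀ hpa (norm_nonneg _) two_ne_zero
  obtain rfl : s = 1 - t := by linarith
  nlinarith [sq_nonneg (t - 1 / 2)]

theorem eq_of_mem_segment {a b : V} {p : ℂ} (h : P.graph.Adj a b)
    (hp : p ∈ segment ℝ (P.pos a) (P.pos b)) :
    p = P.pos a + ‖p - P.pos a‖ * (P.pos b - P.pos a) := by
  rw [segment_eq_image'] at hp
  obtain ⟨t, ht, rfl⟩ := hp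
  dsimp only
  rw [add_sub_cancel_left, norm_smul, P.norm_of_adj h, mul_one, Real.norm_of_nonneg ht.1,
    Complex.real_smul]

theorem exists_adj_of_mem_net {a : V} {p : ℂ} (hp : p ∈ P.net) (hpa : ‖p - P.pos a‖ < 3 / 4) :
    ∃ b, P.graph.Adj a b ∧ p = P.pos a + ‖p - P.pos a‖ * (P.pos b - P.pos a) := by
  obtain ⟨v, w, h, hp⟩ := hp
  obtain rfl | rfl := P.eq_or_eq_of_mem_segment h hp hpa
  · exact ⟨w, h, P.eq_of_mem_segment h hp⟩
  · exact ⟨v, h.symm, P.eq_of_mem_segment h.symm (by rwa [segment_symm])⟩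

theorem mem_net_of_adj {a b : V} (h : P.graph.Adj a b) {ρ : ℝ} (h0 : 0 ≤ ρ) (h1 : ρ ≤ 1) :
    P.pos a + ρ * (P.pos b - P.pos a) ∈ P.net := by
  refine ⟨a, b, h, ?_⟩
  rw [segment_eq_image']
  exact ⟨ρ, ⟨h0, h1⟩, by simp⟩

theorem net_eq_iUnion : P.net = ⋃ d : P.graph.Dart, segment ℝ (P.pos d.fst) (P.pos d.snd) := by
  ext p
  simp only [Set.mem_iUnion]
  exact ⟨fun ⟨v, w, hvw, hp⟩ => ⟨⟨(v, w), hvw⟩, hp⟩, fun ⟨d, hd⟩ => ⟨d.fst, d.snd, d.adj, hd⟩⟩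

theorem isClosed_net : IsClosed P.net := by
  rw [net_eq_iUnion]
  refine LocallyFinite.isClosed_iUnion (fun z => ?_) fun d => ?_
  · refine ⟨Metric.ball z 1, Metric.ball_mem_nhds z one_pos, ?_⟩
    have hfin := P.finite_norm_pos_sub_le z 2
    refine Set.Finite.of_finite_image (f := fun d => d.toProd) ((hfin.prod hfin).subset ?_)
      (fun d _ e _ hde => SimpleGraph.Dart.ext _ _ hde)
    rintro _ ⟨d, ⟨p, hp, hpz⟩, rfl⟩
    have hfst := Metric.mem_closedBall'.1 (P.mem_closedBall_of_mem_segment d.adj hp)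
    have hsnd := Metric.mem_closedBall'.1
      (P.mem_closedBall_of_mem_segment d.adj.symm (segment_symm ℝ (P.pos d.fst) _ ▸ hp))
    rw [Metric.mem_ball] at hpz
    constructor <;> rw [Set.mem_ofPred, ← dist_eq_norm]
    · linarith [dist_triangle (P.pos d.fst) p z]
    · linarith [dist_triangle (P.pos d.snd) p z]
  · rw [segment_eq_image']
    exact (isCompact_Icc.image (by fun_prop)).isClosed

/-! ### The rotation system -/

/-- The direction of a dart. -/
noncomputable def dir (d : P.graph.Dart) : ℂ := P.pos d.snd - P.pos d.fst

theorem norm_dir (d : P.graph.Dart) : ‖P.dir d‖ = 1 := P.norm_of_adj d.adj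

theorem dir_ne_zero (d : P.graph.Dart) : P.dir d ≠ 0 := norm_ne_zero_iff.1 (by simp [norm_dir])

theorem dir_symm (d : P.graph.Dart) : P.dir d.symm = -P.dir d := (neg_sub _ _).symm

theorem norm_div_dir {u : ℂ} (hu : ‖u‖ = 1) (d : P.graph.Dart) : ‖u / P.dir d‖ = 1 := by
  rw [norm_div, hu, norm_dir, div_one]

theorem dart_ext {d e : P.graph.Dart} (h : d.fst = e.fst) (h' : P.dir d = P.dir e) : d = e := by
  refine SimpleGraph.Dart.ext _ _ (Prod.ext h (P.unitSeparated_pos.injective ?_))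
  simp only [dir, h] at h'
  exact sub_left_inj.1 h'

theorem finite_darts (v : V) : {d : P.graph.Dart | d.fst = v}.Finite := by
  refine Set.Finite.of_finite_image (f := fun d => d.snd)
    ((P.finite_norm_pos_sub_le (P.pos v) 1).subset ?_) ?_
  · rintro _ ⟨d, rfl, rfl⟩
    exact (P.norm_dir d).le
  · rintro d rfl e he hde
    exact SimpleGraph.Dart.ext _ _ (Prod.ext he.symm hde)

theorem exists_next (d : P.graph.Dart) : ∃ n : P.graph.Dart, n.fst = d.fst ∧
    ∀ e : P.graph.Dart, e.fst = d.fst →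
      ccwAngle (P.dir n / P.dir d) ≤ ccwAngle (P.dir e / P.dir d) :=
  Set.exists_min_image _ (fun e => ccwAngle (P.dir e / P.dir d)) (P.finite_darts d.fst) ⟨d, rfl⟩

/-- The next dart at the same vertex, counterclockwise. -/
noncomputable def next (d : P.graph.Dart) : P.graph.Dart := (P.exists_next d).choose

theorem next_fst (d : P.graph.Dart) : (P.next d).fst = d.fst := (P.exists_next d).choose_spec.1

/-- The counterclockwise angle from a dart to the next one. -/
noncomputable def gap (d : P.graph.Dart) : ℝ := ccwAngle (P.dir (P.next d) / P.dir d)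

theorem gap_le {d e : P.graph.Dart} (h : e.fst = d.fst) :
    P.gap d ≤ ccwAngle (P.dir e / P.dir d) := (P.exists_next d).choose_spec.2 e h

theorem gap_pos (d : P.graph.Dart) : 0 < P.gap d := ccwAngle_pos _

theorem gap_le_two_pi (d : P.graph.Dart) : P.gap d ≤ 2 * Real.pi := ccwAngle_le _

theorem dir_next (d : P.graph.Dart) :
    P.dir (P.next d) = Complex.exp (P.gap d * Complex.I) * P.dir d := by
  rw [gap, exp_ccwAngle (P.norm_div_dir (P.norm_dir _) _), div_mul_cancel₀ _ (P.dir_ne_zero d)]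

theorem ccwAngle_div_dir_next {d : P.graph.Dart} {u : ℂ} (hu : ‖u‖ = 1)
    (h : P.gap d < ccwAngle (u / P.dir d)) :
    ccwAngle (u / P.dir (P.next d)) = ccwAngle (u / P.dir d) - P.gap d := by
  rw [gap, ← ccwAngle_div (P.norm_div_dir (P.norm_dir _) d) (P.norm_div_dir hu d) h,
    div_div_div_cancel_right₀ (P.dir_ne_zero d)]

theorem exists_ccwAngle_le_gap {S : Set P.graph.Dart} {v : V} (hS : S.Nonempty)
    (hv : ∀ d ∈ S, d.fst = v) (hnext : ∀ d ∈ S, P.next d ∈ S) {u : ℂ} (hu : ‖u‖ = 1) :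
    ∃ d ∈ S, ccwAngle (u / P.dir d) ≤ P.gap d := by
  obtain ⟨d, hd, hmin⟩ := Set.exists_min_image S (fun d => ccwAngle (u / P.dir d))
    ((P.finite_darts v).subset hv) hS
  refine ⟨d, hd, not_lt.1 fun hlt => ?_⟩
  have hle := hmin (P.next d) (hnext d hd)
  rw [P.ccwAngle_div_dir_next hu hlt] at hle
  linarith [P.gap_pos d]

theorem exists_mem_next_eq {S : Set P.graph.Dart} {e : P.graph.Dart} (hS : S.Nonempty)
    (hv : ∀ d ∈ S, d.fst = e.fst) (hnext : ∀ d ∈ S, P.next d ∈ S) : ∃ d ∈ S, P.next d = e := by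
  obtain ⟨d, hd, hle⟩ := P.exists_ccwAngle_le_gap hS hv hnext (P.norm_dir e)
  have hfst := hv d hd
  have hangle := ccwAngle_injOn (P.norm_div_dir (P.norm_dir _) _) (P.norm_div_dir (P.norm_dir _) _)
    (hle.antisymm (P.gap_le hfst.symm))
  refine ⟨d, hd, P.dart_ext ((P.next_fst d).trans hfst) ?_⟩
  exact ((div_left_inj' (P.dir_ne_zero d)).1 hangle).symm

theorem next_injective : Function.Injective P.next := by
  intro d e h
  have hmaps : Set.MapsTo P.next {x | x.fst = d.fst} {x | x.fst = d.fst} :=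
    fun x hx => (P.next_fst x).trans hx
  have hsurj : Set.SurjOn P.next {x | x.fst = d.fst} {x | x.fst = d.fst} := fun x hx =>
    P.exists_mem_next_eq ⟨d, rfl⟩ (fun y hy => (hy : y.fst = d.fst).trans hx.symm) hmaps
  refine ((P.finite_darts d.fst).surjOn_iff_bijOn_of_mapsTo hmaps).1 hsurj |>.injOn rfl ?_ h
  exact (P.next_fst e).symm.trans (h ▸ P.next_fst d)

theorem eq_of_next_invariant {α : Type*} (g : P.graph.Dart → α) (hg : ∀ d, g (P.next d) = g d)
    {d e : P.graph.Dart} (h : d.fst = e.fst) : g d = g e := by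
  obtain ⟨m, hm, rfl⟩ := P.exists_mem_next_eq (S := {x | x.fst = d.fst ∧ g x = g d}) (e := e)
    ⟨d, rfl, rfl⟩ (fun x hx => hx.1.trans h)
    fun x hx => ⟨(P.next_fst x).trans hx.1, (hg x).trans hx.2⟩
  rw [hg, hm.2]

/-- The dart before `d` on the boundary walk of the face on the left of `d`. -/
noncomputable def facePred (d : P.graph.Dart) : P.graph.Dart := (P.next d).symm

theorem facePred_snd (d : P.graph.Dart) : (P.facePred d).snd = d.fst := P.next_fst d

theorem facePred_injective : Function.Injective P.facePred :=
  SimpleGraph.Dart.symm_involutive.injective.comp P.next_injective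

open Filter Topology

/-! ### Sectors and faces -/

/-- The point at distance `ρ` from the initial vertex of `d`, at the angle `t` from `d`. -/
noncomputable def polarPt (d : P.graph.Dart) (ρ t : ℝ) : ℂ :=
  P.pos d.fst + ρ * Complex.exp (t * Complex.I) * P.dir d

/-- The open sector between a dart and the next one. The radius `3/4` is larger than the radius of
a penny, so that sectors of adjacent vertices overlap, but small enough for the net to meet the
disk of this radius in edges at its center only. -/
noncomputable def sector (d : P.graph.Dart) : Set ℂ :=
  (fun x : ℝ × ℝ => P.polarPt d x.1 x.2) '' (Set.Ioo 0 (3 / 4) ×ˢ Set.Ioo 0 (P.gap d))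

/-- A point that represents the sector of a dart. -/
noncomputable def sectorPt (d : P.graph.Dart) : ℂ := P.polarPt d (1 / 4) (P.gap d / 2)

/-- The face on the left of a dart. -/
noncomputable def faceOf (d : P.graph.Dart) : Set ℂ := connectedComponentIn P.netᶜ (P.sectorPt d)

theorem norm_polarPt_sub (d : P.graph.Dart) {ρ : ℝ} (hρ : 0 ≤ ρ) (t : ℝ) :
    ‖P.polarPt d ρ t - P.pos d.fst‖ = ρ := by
  rw [polarPt, add_sub_cancel_left, norm_mul, norm_mul, norm_dir, Complex.norm_exp_ofReal_mul_I,
    Complex.norm_real, Real.norm_of_nonneg hρ, mul_one, mul_one]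

theorem polarPt_next (d : P.graph.Dart) (ρ t : ℝ) :
    P.polarPt (P.next d) ρ t = P.polarPt d ρ (P.gap d + t) := by
  rw [polarPt, polarPt, next_fst, dir_next, Complex.ofReal_add, add_mul, Complex.exp_add]
  ring

theorem sectorPt_mem_sector (d : P.graph.Dart) : P.sectorPt d ∈ P.sector d :=
  ⟨(1 / 4, P.gap d / 2), ⟨⟨by norm_num, by norm_num⟩, half_pos (P.gap_pos d),
    half_lt_self (P.gap_pos d)⟩, rfl⟩

theorem sector_subset (d : P.graph.Dart) : P.sector d ⊆ P.netᶜ := by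
  rintro _ ⟨⟨ρ, t⟩, ⟨⟨hρ0, hρ1⟩, ht0, ht1⟩, rfl⟩ hnet
  dsimp only at hρ0 hρ1 ht0 ht1 hnet
  have hnorm := P.norm_polarPt_sub d hρ0.le t
  obtain ⟨b, hb, hpb⟩ := P.exists_adj_of_mem_net (a := d.fst) hnet (hnorm.trans_lt hρ1)
  let e : P.graph.Dart := ⟨(d.fst, b), hb⟩
  have hdir : Complex.exp (t * Complex.I) * P.dir d = P.dir e := by
    rw [hnorm, polarPt, mul_assoc] at hpb
    exact mul_left_cancel₀ (Complex.ofReal_ne_zero.2 hρ0.ne') (add_left_cancel hpb)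
  have hgap := P.gap_le (d := d) (e := e) rfl
  rw [← hdir, mul_div_cancel_right₀ _ (P.dir_ne_zero d),
    ccwAngle_exp ht0 (ht1.le.trans (P.gap_le_two_pi d))] at hgap
  exact ht1.not_ge hgap

theorem isPreconnected_sector (d : P.graph.Dart) : IsPreconnected (P.sector d) := by
  refine (isPreconnected_Ioo.prod isPreconnected_Ioo).image _ ?_
  unfold polarPt
  fun_prop

theorem sector_subset_faceOf (d : P.graph.Dart) : P.sector d ⊆ P.faceOf d :=
  (P.isPreconnected_sector d).subset_connectedComponentIn (P.sectorPt_mem_sector d)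
    (P.sector_subset d)

theorem faceOf_subset (d : P.graph.Dart) : P.faceOf d ⊆ P.netᶜ := connectedComponentIn_subset _ _

theorem sectorPt_mem_faceOf (d : P.graph.Dart) : P.sectorPt d ∈ P.faceOf d :=
  P.sector_subset_faceOf d (P.sectorPt_mem_sector d)

theorem sectorPt_notMem_net (d : P.graph.Dart) : P.sectorPt d ∉ P.net :=
  P.faceOf_subset d (P.sectorPt_mem_faceOf d)

theorem faceOf_eq_of_mem {d : P.graph.Dart} {p : ℂ} (h : p ∈ P.faceOf d) :
    P.faceOf d = connectedComponentIn P.netᶜ p := connectedComponentIn_eq h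

theorem faceOf_eq_of_mem_of_mem {d e : P.graph.Dart} {p : ℂ} (h : p ∈ P.faceOf d)
    (he : p ∈ P.faceOf e) : P.faceOf d = P.faceOf e := by
  rw [P.faceOf_eq_of_mem h, P.faceOf_eq_of_mem he]

theorem exists_mem_sector {a b : V} (hab : P.graph.Adj a b) {q : ℂ} (hq : q ∉ P.net)
    (hqa : ‖q - P.pos a‖ < 3 / 4) : ∃ d : P.graph.Dart, d.fst = a ∧ q ∈ P.sector d := by
  have hne : q ≠ P.pos a := by
    rintro rfl
    exact hq ⟨a, b, hab, left_mem_segment ℝ _ _⟩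
  have hρ : 0 < ‖q - P.pos a‖ := norm_pos_iff.2 (sub_ne_zero.2 hne)
  set ρ := ‖q - P.pos a‖ with hρ_def
  have hρc : (ρ : ℂ) ≠ 0 := Complex.ofReal_ne_zero.2 hρ.ne'
  set u : ℂ := (q - P.pos a) / ρ with hu_def
  have hqu : q = P.pos a + ρ * u := by rw [hu_def, mul_div_cancel₀ _ hρc, add_sub_cancel]
  have hu : ‖u‖ = 1 := by
    rw [hu_def, norm_div, Complex.norm_real, norm_norm, ← hρ_def, div_self hρ.ne']
  obtain ⟨d, rfl, hd⟩ := P.exists_ccwAngle_le_gap (S := {d | d.fst = a}) ⟨⟨(a, b), hab⟩, rfl⟩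
    (fun _ => id) (fun d hd => (P.next_fst d).trans hd) hu
  have hud : Complex.exp (ccwAngle (u / P.dir d) * Complex.I) * P.dir d = u := by
    rw [exp_ccwAngle (P.norm_div_dir hu d), div_mul_cancel₀ _ (P.dir_ne_zero d)]
  refine ⟨d, rfl, (ρ, ccwAngle (u / P.dir d)), ⟨⟨hρ, hqa⟩, ccwAngle_pos _, hd.lt_of_ne ?_⟩, ?_⟩
  · intro heq
    rw [heq, ← dir_next] at hud
    have hmem := P.mem_net_of_adj (P.next d).adj hρ.le (by linarith)
    rw [← dir, next_fst, hud, ← hqu] at hmem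
    exact hq hmem
  · dsimp only
    rw [polarPt, mul_assoc, hud, ← hqu]

/-- The point on the perpendicular bisector of `d` that is seen at the angle `t` from `d`. -/
noncomputable def sidePt (d : P.graph.Dart) (t : ℝ) : ℂ := P.polarPt d (1 / (2 * Real.cos t)) t

theorem sidePt_eq (d : P.graph.Dart) {t : ℝ} (ht : Real.cos t ≠ 0) :
    P.sidePt d t = P.pos d.fst + (1 / 2 + Real.tan t / 2 * Complex.I) * P.dir d := by
  have ht' : Complex.cos t ≠ 0 := by exact_mod_cast ht
  rw [sidePt, polarPt, Complex.exp_mul_I, Real.tan_eq_sin_div_cos]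
  push_cast
  field_simp

theorem sidePt_symm (d : P.graph.Dart) {t : ℝ} (ht : Real.cos t ≠ 0) :
    P.sidePt d.symm t = P.sidePt d (-t) := by
  rw [sidePt_eq _ _ ht, sidePt_eq _ _ (by rwa [Real.cos_neg]), dir_symm, Real.tan_neg,
    show P.pos d.symm.fst = P.pos d.fst + P.dir d from (add_sub_cancel _ _).symm]
  push_cast
  ring

theorem eventually_half_inv_cos_mem :
    ∀ᶠ t : ℝ in 𝓝 0, 1 / (2 * Real.cos t) ∈ Set.Ioo 0 (3 / 4) := by
  refine ContinuousAt.eventually_mem ?_ (isOpen_Ioo.mem_nhds ?_)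
  · exact ContinuousAt.div (by fun_prop) (by fun_prop) (by norm_num)
  · norm_num

theorem eventually_sidePt_mem_sector (d : P.graph.Dart) :
    ∀ᶠ t : ℝ in 𝓝[>] 0, P.sidePt d t ∈ P.sector d := by
  filter_upwards [nhdsWithin_le_nhds eventually_half_inv_cos_mem,
    Ioo_mem_nhdsGT (P.gap_pos d)] with t hρ ht
  exact ⟨(1 / (2 * Real.cos t), t), ⟨hρ, ht⟩, rfl⟩

theorem eventually_sidePt_facePred_mem_sector (d : P.graph.Dart) :
    ∀ᶠ t : ℝ in 𝓝[>] 0, P.sidePt (P.facePred d) t ∈ P.sector d := by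
  filter_upwards [nhdsWithin_le_nhds eventually_half_inv_cos_mem,
    Ioo_mem_nhdsGT (P.gap_pos d)] with t hρ ht
  have hcos : Real.cos t ≠ 0 := by
    intro h
    simp [h] at hρ
  rw [facePred, sidePt_symm _ _ hcos, sidePt, Real.cos_neg, polarPt_next]
  exact ⟨(_, _), ⟨hρ, by linarith [ht.2], by linarith [ht.1]⟩, rfl⟩

theorem faceOf_facePred (d : P.graph.Dart) : P.faceOf (P.facePred d) = P.faceOf d := by
  obtain ⟨t, h, h'⟩ := ((P.eventually_sidePt_mem_sector (P.facePred d)).and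
    (P.eventually_sidePt_facePred_mem_sector d)).exists
  exact P.faceOf_eq_of_mem_of_mem (P.sector_subset_faceOf _ h) (P.sector_subset_faceOf _ h')

open Real

/-! ### Winding numbers of families of darts -/

/-- The signed angle, in `(-π, π]`, under which a dart is seen from `p`. -/
noncomputable def viewAngle (d : P.graph.Dart) (p : ℂ) : ℝ :=
  Complex.arg ((P.pos d.snd - p) / (P.pos d.fst - p))

/-- The total angle under which a finite family of darts is seen from `p`. For the boundary walk of
a face this is `2π` times the winding number around `p`. -/
noncomputable def winding (O : Finset P.graph.Dart) (p : ℂ) : ℝ := ∑ d ∈ O, P.viewAngle d p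

theorem continuousAt_viewAngle {d : P.graph.Dart} {p : ℂ}
    (hp : p ∉ segment ℝ (P.pos d.fst) (P.pos d.snd)) : ContinuousAt (P.viewAngle d) p := by
  have hne : P.pos d.fst - p ≠ 0 := fun h => hp (sub_eq_zero.1 h ▸ left_mem_segment ℝ _ _)
  refine ContinuousAt.comp (f := fun q => (P.pos d.snd - q) / (P.pos d.fst - q))
    (Complex.continuousAt_arg ?_) (ContinuousAt.div (by fun_prop) (by fun_prop) hne)
  rw [Complex.mem_slitPlane_iff_arg]
  refine ⟨fun hπ => hp ?_, div_ne_zero (fun h => hp ?_) hne⟩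
  · obtain ⟨hre, him⟩ := Complex.arg_eq_pi_iff.1 hπ
    rw [mem_segment_iff_sameRay, SameRay.sameRay_comm, Complex.sameRay_iff_arg_div_eq_zero,
      ← neg_sub (P.pos d.fst), div_neg, Complex.arg_eq_zero_iff, Complex.neg_re, Complex.neg_im]
    exact ⟨neg_nonneg.2 hre.le, neg_eq_zero.2 him⟩
  · exact sub_eq_zero.1 h ▸ right_mem_segment ℝ _ _

theorem continuousOn_winding (O : Finset P.graph.Dart) : ContinuousOn (P.winding O) P.netᶜ :=
  continuousOn_finsetSum _ fun d _ _ hp =>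
    (P.continuousAt_viewAngle fun h => hp ⟨_, _, d.adj, h⟩).continuousWithinAt

theorem pos_sub_ne_zero {p : ℂ} (hp : p ∉ P.net) (d : P.graph.Dart) : P.pos d.fst - p ≠ 0 :=
  fun h => hp ⟨_, _, d.adj, sub_eq_zero.1 h ▸ left_mem_segment ℝ _ _⟩

variable {P}

theorem sum_snd_eq_sum_fst {M : Type*} [AddCommMonoid M] {O : Finset P.graph.Dart}
    (hO : ∀ d, P.facePred d ∈ O ↔ d ∈ O) (F : V → M) : ∑ d ∈ O, F d.snd = ∑ d ∈ O, F d.fst := by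
  have hmaps : Set.MapsTo P.facePred O O := fun d hd => (hO d).2 hd
  have hinj := P.facePred_injective.injOn (s := O)
  refine (Finset.sum_nbij P.facePred hmaps hinj ?_ fun d _ => ?_).symm
  · exact ((O.finite_toSet.injOn_iff_bijOn_of_mapsTo hmaps).1 hinj).surjOn
  · rw [facePred_snd]

theorem winding_mem_zmultiples {O : Finset P.graph.Dart} (hO : ∀ d, P.facePred d ∈ O ↔ d ∈ O)
    {p : ℂ} (hp : p ∉ P.net) : P.winding O p ∈ AddSubgroup.zmultiples (2 * π) := by
  have hview : ∀ d, (P.viewAngle d p : Angle) =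
      Complex.arg (P.pos d.snd - p) - Complex.arg (P.pos d.fst - p) := fun d =>
    Complex.arg_div_coe_angle (P.pos_sub_ne_zero hp d.symm) (P.pos_sub_ne_zero hp d)
  refine AddSubgroup.mem_zmultiples_iff.2 (Angle.coe_eq_zero_iff.1 ?_)
  calc (P.winding O p : Angle) = ∑ d ∈ O, (P.viewAngle d p : Angle) := map_sum Angle.coeHom _ _
    _ = ∑ d ∈ O, (Complex.arg (P.pos d.snd - p) : Angle) -
        ∑ d ∈ O, (Complex.arg (P.pos d.fst - p) : Angle) := by
      simp only [hview, Finset.sum_sub_distrib]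
    _ = 0 := sub_eq_zero.2 (sum_snd_eq_sum_fst hO fun v => (Complex.arg (P.pos v - p) : Angle))

theorem winding_eq_of_mem_faceOf {O : Finset P.graph.Dart} (hO : ∀ d, P.facePred d ∈ O ↔ d ∈ O)
    {d : P.graph.Dart} {p : ℂ} (hp : p ∈ P.faceOf d) :
    P.winding O p = P.winding O (P.sectorPt d) :=
  isPreconnected_connectedComponentIn.constant_of_mapsTo
    (T := (AddSubgroup.zmultiples (2 * π) : Set ℝ))
    ⟨inferInstanceAs (DiscreteTopology (AddSubgroup.zmultiples (2 * π)))⟩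
    ((P.continuousOn_winding O).mono (P.faceOf_subset d))
    (fun _ hx => winding_mem_zmultiples hO (P.faceOf_subset d hx)) hp (P.sectorPt_mem_faceOf d)

/-! ### The jump of the winding number across an edge -/

variable (P)

theorem viewAngle_sidePt (d : P.graph.Dart) {t : ℝ} (ht : cos t ≠ 0) :
    P.viewAngle d (P.sidePt d t) = toIocMod two_pi_pos (-π) (π - 2 * t) := by
  have hcos : Complex.cos t ≠ 0 := by exact_mod_cast ht
  have hfst : P.pos d.fst - P.sidePt d t =
      -Complex.exp (t * Complex.I) * (P.dir d / (2 * Complex.cos t)) := by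
    rw [sidePt, polarPt]
    push_cast
    ring
  have hsnd : P.pos d.snd - P.sidePt d t =
      Complex.exp (-t * Complex.I) * (P.dir d / (2 * Complex.cos t)) := by
    rw [sidePt_eq _ _ ht, Complex.exp_mul_I, Complex.cos_neg, Complex.sin_neg,
      tan_eq_sin_div_cos, dir]
    push_cast
    field_simp
    ring
  have hquot : (P.pos d.snd - P.sidePt d t) / (P.pos d.fst - P.sidePt d t) =
      Complex.exp ((π - 2 * t : ℝ) * Complex.I) := by
    rw [hfst, hsnd, mul_div_mul_right _ _ (div_ne_zero (P.dir_ne_zero d) (by simpa using hcos)),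
      div_neg, ← Complex.exp_sub, ← neg_one_mul, ← Complex.exp_pi_mul_I, ← Complex.exp_add]
    push_cast
    ring_nf
  rw [viewAngle, hquot, Complex.arg_exp_mul_I]

theorem tendsto_viewAngle_sidePt_sub (d : P.graph.Dart) :
    Tendsto (fun t => P.viewAngle d (P.sidePt d t) - P.viewAngle d (P.sidePt d (-t))) (𝓝[>] 0)
      (𝓝 (2 * π)) := by
  have hlim : Tendsto (fun t : ℝ => 2 * π - 4 * t) (𝓝[>] 0) (𝓝 (2 * π)) := by
    refine (Continuous.tendsto' (by fun_prop) 0 _ ?_).mono_left nhdsWithin_le_nhds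
    simp only [mul_zero, sub_zero]
  refine hlim.congr' ?_
  filter_upwards [Ioo_mem_nhdsGT pi_div_two_pos] with t ⟨ht0, ht1⟩
  have hcos : cos t ≠ 0 := (cos_pos_of_mem_Ioo ⟨by linarith, ht1⟩).ne'
  have hneg : π - 2 * -t = 2 * t - π + 2 * π := by ring
  rw [viewAngle_sidePt _ _ hcos, viewAngle_sidePt _ _ (by rwa [cos_neg]), hneg, toIocMod_add_right,
    (toIocMod_eq_self _).2 ⟨by linarith, by linarith⟩,
    (toIocMod_eq_self _).2 ⟨by linarith, by linarith⟩]
  ring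

theorem sidePt_zero_notMem {d e : P.graph.Dart} (hd : e ≠ d) (hds : e ≠ d.symm) :
    P.sidePt d 0 ∉ segment ℝ (P.pos e.fst) (P.pos e.snd) := by
  intro hmem
  have hcos : cos 0 ≠ 0 := by rw [cos_zero]; exact one_ne_zero
  have hnear : ∀ d, ‖P.sidePt d 0 - P.pos d.fst‖ < 3 / 4 := fun d => by
    rw [sidePt, norm_polarPt_sub _ _ (by rw [cos_zero]; norm_num), cos_zero]
    norm_num
  have hnear' := hnear d.symm
  rw [sidePt_symm _ _ hcos, neg_zero] at hnear'
  obtain h | h := P.eq_or_eq_of_mem_segment e.adj hmem (hnear d) <;>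
    obtain h' | h' := P.eq_or_eq_of_mem_segment e.adj hmem hnear'
  · exact d.adj.ne (h.trans h'.symm)
  · exact hd (SimpleGraph.Dart.ext _ _ (Prod.ext h.symm h'.symm))
  · exact hds (SimpleGraph.Dart.ext _ _ (Prod.ext h'.symm h.symm))
  · exact d.adj.ne (h.trans h'.symm)

theorem tendsto_viewAngle_sidePt_sub_of_ne {d e : P.graph.Dart} (hd : e ≠ d) (hds : e ≠ d.symm) :
    Tendsto (fun t => P.viewAngle e (P.sidePt d t) - P.viewAngle e (P.sidePt d (-t))) (𝓝[>] 0)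
      (𝓝 0) := by
  have hside : ContinuousAt (P.sidePt d) 0 := by
    unfold sidePt polarPt
    fun_prop (disch := simp)
  have hview : ContinuousAt (fun t => P.viewAngle e (P.sidePt d t)) 0 :=
    (P.continuousAt_viewAngle (P.sidePt_zero_notMem hd hds)).comp hside
  have hview' : ContinuousAt (fun t => P.viewAngle e (P.sidePt d (-t))) 0 :=
    ContinuousAt.comp' (f := fun t : ℝ => -t) (by rwa [neg_zero]) continuous_neg.continuousAt
  have hsub := hview.tendsto.sub hview'.tendsto
  rw [neg_zero, sub_self] at hsub
  exact hsub.mono_left nhdsWithin_le_nhds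

theorem symm_ne (d : P.graph.Dart) : d.symm ≠ d := fun h =>
  d.adj.ne (congrArg (fun x : P.graph.Dart => x.fst) h).symm

theorem eventually_cos_ne_zero : ∀ᶠ t : ℝ in 𝓝[>] 0, cos t ≠ 0 := by
  filter_upwards [Ioo_mem_nhdsGT pi_div_two_pos] with t ht
  exact (cos_pos_of_mem_Ioo ⟨by linarith [ht.1, pi_pos], ht.2⟩).ne'

open Classical in
theorem tendsto_viewAngle_jump (d e : P.graph.Dart) :
    Tendsto (fun t => P.viewAngle e (P.sidePt d t) - P.viewAngle e (P.sidePt d (-t))) (𝓝[>] 0)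
      (𝓝 ((if e = d then 2 * π else 0) - if e = d.symm then 2 * π else 0)) := by
  by_cases hd : e = d
  · subst hd
    rw [if_pos rfl, if_neg (symm_ne P e).symm, sub_zero]
    exact P.tendsto_viewAngle_sidePt_sub e
  by_cases hds : e = d.symm
  · subst hds
    rw [if_neg hd, if_pos rfl, zero_sub]
    refine (P.tendsto_viewAngle_sidePt_sub d.symm).neg.congr' ?_
    filter_upwards [eventually_cos_ne_zero] with t ht
    rw [sidePt_symm _ _ ht, sidePt_symm _ _ (by rwa [cos_neg]), neg_neg, neg_sub]
  · rw [if_neg hd, if_neg hds, sub_zero]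
    exact P.tendsto_viewAngle_sidePt_sub_of_ne hd hds

open Classical in
theorem winding_jump {O : Finset P.graph.Dart} (hO : ∀ d, P.facePred d ∈ O ↔ d ∈ O)
    (d : P.graph.Dart) :
    P.winding O (P.sectorPt d) - P.winding O (P.sectorPt d.symm) =
      (if d ∈ O then 2 * π else 0) - if d.symm ∈ O then 2 * π else 0 := by
  have hlim := tendsto_finsetSum O fun e _ => P.tendsto_viewAngle_jump d e
  rw [Finset.sum_sub_distrib, Finset.sum_ite_eq', Finset.sum_ite_eq'] at hlim
  refine tendsto_nhds_unique (tendsto_const_nhds.congr' ?_) hlim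
  filter_upwards [P.eventually_sidePt_mem_sector d, P.eventually_sidePt_mem_sector d.symm,
    eventually_cos_ne_zero] with t hleft hright hcos
  rw [← winding_eq_of_mem_faceOf hO (P.sector_subset_faceOf _ hleft),
    ← winding_eq_of_mem_faceOf hO (P.sector_subset_faceOf _ hright), sidePt_symm _ _ hcos,
    winding, winding, Finset.sum_sub_distrib]

/-! ### The winding number of a face boundary -/

theorem abs_viewAngle_le {d : P.graph.Dart} {p : ℂ} (h : 2 ≤ ‖P.pos d.fst - p‖) :
    |P.viewAngle d p| ≤ 3 / 2 / ‖P.pos d.fst - p‖ := by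
  have hne : P.pos d.fst - p ≠ 0 := norm_pos_iff.1 (two_pos.trans_le h)
  have hquot : (P.pos d.snd - p) / (P.pos d.fst - p) = 1 + P.dir d / (P.pos d.fst - p) := by
    rw [dir, one_add_div hne, add_comm, sub_add_sub_cancel]
  have hnorm : ‖P.dir d / (P.pos d.fst - p)‖ = 1 / ‖P.pos d.fst - p‖ := by
    rw [norm_div, norm_dir]
  have hlog := Complex.norm_log_one_add_half_le_self
    (hnorm.trans_le (one_div_le_one_div_of_le two_pos h))
  rw [viewAngle, hquot, ← Complex.log_im]
  refine (Complex.abs_im_le_norm _).trans (hlog.trans_eq ?_)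
  rw [hnorm, mul_one_div]

variable {P}

theorem winding_eq_zero_of_far {O : Finset P.graph.Dart} (hO : ∀ d, P.facePred d ∈ O ↔ d ∈ O)
    {p : ℂ} (hp : p ∉ P.net) (hfar : ∀ d ∈ O, O.card + 2 ≤ ‖P.pos d.fst - p‖) :
    P.winding O p = 0 := by
  obtain ⟨n, hn⟩ := AddSubgroup.mem_zmultiples_iff.1 (winding_mem_zmultiples hO hp)
  have hsmall : |P.winding O p| < 2 * π := calc
    |P.winding O p| ≤ ∑ d ∈ O, |P.viewAngle d p| := Finset.abs_sum_le_sum_abs _ _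
    _ ≤ O.card • (3 / 2 / (O.card + 2)) := by
      refine Finset.sum_le_card_nsmul _ _ _ fun d hd => ?_
      refine (P.abs_viewAngle_le (by linarith [hfar d hd])).trans ?_
      exact div_le_div_of_nonneg_left (by norm_num) (by linarith) (hfar d hd)
    _ ≤ 3 / 2 := by
      rw [nsmul_eq_mul, ← mul_div_assoc, div_le_iff₀ (by linarith)]
      linarith
    _ < 2 * π := by linarith [pi_gt_three]
  rw [← hn, zsmul_eq_mul, abs_mul, abs_of_pos two_pi_pos, mul_lt_iff_lt_one_left two_pi_pos,
    ← Int.cast_abs, ← Int.cast_one, Int.cast_lt, Int.abs_lt_one_iff] at hsmall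
  rw [← hn, hsmall, zero_zsmul]

theorem eq_of_symm_facePred_invariant (hconn : P.graph.Connected) {α : Type*}
    {g : P.graph.Dart → α} (hsymm : ∀ d, g d.symm = g d) (hpred : ∀ d, g (P.facePred d) = g d)
    (d e : P.graph.Dart) : g d = g e := by
  have hnext : ∀ d, g (P.next d) = g d := fun d => (hsymm _).symm.trans (hpred d)
  have hwalk : ∀ {u v : V} (_ : P.graph.Walk u v) (d e : P.graph.Dart), d.fst = u → e.fst = v →
      g d = g e := by
    intro u v p
    induction p with
    | nil => exact fun d e hd he => P.eq_of_next_invariant g hnext (hd.trans he.symm)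
    | @cons u v w h _ ih =>
      intro d e hd he
      let f : P.graph.Dart := ⟨(u, v), h⟩
      rw [P.eq_of_next_invariant g hnext (e := f) hd, ← hsymm f]
      exact ih f.symm e rfl he
  obtain ⟨p⟩ := hconn.preconnected d.fst e.fst
  exact hwalk p d e rfl rfl

variable [Infinite V]

theorem exists_dart_fst (hconn : P.graph.Connected) (v : V) : ∃ d : P.graph.Dart, d.fst = v := by
  obtain ⟨w, hw⟩ := hconn.preconnected.exists_adj_of_nontrivial v
  exact ⟨⟨(v, w), hw⟩, rfl⟩

theorem exists_dart_far (hconn : P.graph.Connected) (O : Finset P.graph.Dart) (r : ℝ) :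
    ∃ e, ∀ d ∈ O, r ≤ ‖P.pos d.fst - P.sectorPt e‖ := by
  have hfin : (⋃ d ∈ O, {v | ‖P.pos v - P.pos d.fst‖ ≤ r + 1 / 4}).Finite :=
    O.finite_toSet.biUnion fun d _ => P.finite_norm_pos_sub_le (P.pos d.fst) _
  obtain ⟨v, hv⟩ := hfin.exists_notMem
  simp only [Set.mem_iUnion, Set.mem_ofPred_eq, not_exists, not_le] at hv
  obtain ⟨e, rfl⟩ := exists_dart_fst hconn v
  refine ⟨e, fun d hd => ?_⟩
  have he : ‖P.sectorPt e - P.pos e.fst‖ = 1 / 4 := P.norm_polarPt_sub e (by norm_num) _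
  have htri := norm_sub_le_norm_sub_add_norm_sub (P.pos d.fst) (P.sectorPt e) (P.pos e.fst)
  have hde := hv d hd
  rw [norm_sub_rev] at hde
  linarith

open Classical in
theorem winding_sectorPt (hconn : P.graph.Connected) {O : Finset P.graph.Dart}
    (hO : ∀ d, P.facePred d ∈ O ↔ d ∈ O) (d : P.graph.Dart) :
    P.winding O (P.sectorPt d) = if d ∈ O then 2 * π else 0 := by
  have hpred : ∀ d, P.winding O (P.sectorPt (P.facePred d)) = P.winding O (P.sectorPt d) :=
    fun d => winding_eq_of_mem_faceOf hO (P.faceOf_facePred d ▸ P.sectorPt_mem_faceOf _)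
  let g : P.graph.Dart → ℝ := fun d => P.winding O (P.sectorPt d) - if d ∈ O then 2 * π else 0
  have hconst : ∀ d e, g d = g e := eq_of_symm_facePred_invariant hconn
    (fun d => by linarith [P.winding_jump hO d]) (fun d => by simp only [g, hpred, hO])
  obtain ⟨e, hfar⟩ := exists_dart_far hconn O (O.card + 2)
  have heO : e ∉ O := fun h => by
    have hlt := hfar e h
    rw [norm_sub_rev, sectorPt, norm_polarPt_sub _ _ (by norm_num)] at hlt
    linarith [(Nat.cast_nonneg O.card : (0 : ℝ) ≤ O.card)]
  have he : g e = 0 := by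
    simp only [g]
    rw [if_neg heO, winding_eq_zero_of_far hO (P.sectorPt_notMem_net e) hfar, sub_zero]
  exact sub_eq_zero.1 ((hconst d e).trans he)

theorem mem_of_faceOf_eq (hconn : P.graph.Connected) {O : Finset P.graph.Dart}
    (hO : ∀ d, P.facePred d ∈ O ↔ d ∈ O) {d e : P.graph.Dart} (h : P.faceOf d = P.faceOf e)
    (hd : d ∈ O) : e ∈ O := by
  have hw := winding_eq_of_mem_faceOf hO (h ▸ P.sectorPt_mem_faceOf d)
  rw [winding_sectorPt hconn hO, winding_sectorPt hconn hO, if_pos hd] at hw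
  by_contra he
  rw [if_neg he] at hw
  exact two_pi_pos.ne' hw

theorem exists_near_of_mem_faceOf (hconn : P.graph.Connected) {O : Finset P.graph.Dart}
    (hO : ∀ d, P.facePred d ∈ O ↔ d ∈ O) {d : P.graph.Dart} (hd : d ∈ O) {p : ℂ}
    (hp : p ∈ P.faceOf d) : ∃ e ∈ O, ‖P.pos e.fst - p‖ < O.card + 2 := by
  by_contra! hfar
  have hw := winding_eq_zero_of_far hO (P.faceOf_subset d hp) hfar
  rw [winding_eq_of_mem_faceOf hO hp, winding_sectorPt hconn hO, if_pos hd] at hw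
  exact two_pi_pos.ne' hw

end PennyConfiguration

/-! ### Faces of bounded degree -/

theorem exists_finset_orbit {α : Type*} {f : α → α} (hf : Function.Injective f) {a : α}
    {s : Set α} (hs : s.Finite) (hmem : ∀ k, f^[k] a ∈ s) :
    ∃ O : Finset α, a ∈ O ∧ (O : Set α) ⊆ s ∧ (∀ b, f b ∈ O ↔ b ∈ O) ∧
      ∀ b ∈ O, ∃ k < O.card, f^[k] a = b := by
  classical
  have hper : a ∈ Function.periodicPts f := by
    obtain ⟨i, -, j, -, hij, h⟩ :=
      Set.infinite_univ.exists_lt_map_eq_of_mapsTo (fun k _ => hmem k) hs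
    refine Function.mk_mem_periodicPts (Nat.sub_pos_of_lt hij) ?_
    exact (Function.iterate_cancel hf h.symm : f^[j - i] a = a)
  let n := Function.minimalPeriod f a
  have hn : 0 < n := Function.minimalPeriod_pos_of_mem_periodicPts hper
  let O : Finset α := (Finset.range n).image fun k => f^[k] a
  have hO : ∀ k, f^[k] a ∈ O := fun k => Finset.mem_image.2
    ⟨k % n, Finset.mem_range.2 (Nat.mod_lt _ hn), Function.iterate_mod_minimalPeriod_eq⟩
  have hcard : O.card = n := by
    rw [Finset.card_image_of_injOn, Finset.card_range]
    exact Function.iterate_injOn_Iio_minimalPeriod.mono fun k hk => Finset.mem_range.1 hk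
  have hex : ∀ b ∈ O, ∃ k < n, f^[k] a = b := by simp [O]
  refine ⟨O, hO 0, fun b hb => ?_, fun b => ⟨fun hb => ?_, fun hb => ?_⟩, hcard ▸ hex⟩
  · obtain ⟨k, -, rfl⟩ := hex b hb
    exact hmem k
  · obtain ⟨k, -, hk⟩ := hex _ hb
    have hfb : f (f^[k + (n - 1)] a) = f b := by
      rw [← Function.iterate_succ_apply' f, ← hk, Nat.succ_eq_add_one, add_assoc,
        Nat.sub_add_cancel hn, Function.iterate_add_minimalPeriod_eq]
    exact hf hfb ▸ hO _
  · obtain ⟨k, -, rfl⟩ := hex _ hb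
    exact Function.iterate_succ_apply' f k a ▸ hO (k + 1)

section Walks

variable {U α : Type*} [AddCommMonoid α] [PartialOrder α] [IsOrderedAddMonoid α]
  {H : SimpleGraph U} {δ : U → U → α} {N : α} {v w : U}

theorem le_length_nsmul (hself : ∀ a, δ a a ≤ 0) (htri : ∀ a b c, δ a c ≤ δ a b + δ b c)
    (hadj : ∀ a b, H.Adj a b → δ a b ≤ N) (p : H.Walk v w) : δ v w ≤ p.length • N := by
  induction p with
  | nil => simpa using hself _
  | @cons u v w h p ih =>
    rw [SimpleGraph.Walk.length_cons, succ_nsmul']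
    exact (htri u v w).trans (add_le_add (hadj u v h) ih)

theorem le_card_nsmul [Fintype U] (hself : ∀ a, δ a a ≤ 0)
    (htri : ∀ a b c, δ a c ≤ δ a b + δ b c) (hN : 0 ≤ N) (hadj : ∀ a b, H.Adj a b → δ a b ≤ N)
    (h : H.Reachable v w) : δ v w ≤ Fintype.card U • N := by
  obtain ⟨p, hp⟩ := h.exists_isPath
  exact (le_length_nsmul hself htri hadj p).trans (nsmul_le_nsmul_left hN hp.length_lt.le)

end Walks

namespace PennyConfiguration

open Filter Topology

variable {V : Type*} (P : PennyConfiguration V)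

/-- Every face meets at most `D` pennies. -/
def FaceBound (D : ℕ) : Prop :=
  ∀ d : P.graph.Dart, {v | ∃ q ∈ P.faceOf d, ‖q - P.pos v‖ < 1 / 2}.encard ≤ D

theorem planeEquiv_mem_net_iff [Infinite V] (hconn : P.graph.Connected) (p : Plane) :
    planeEquiv p ∈ P.net ↔ p ∈ P.skeleton := by
  have hseg : ∀ v w : V, planeEquiv p ∈ segment ℝ (P.pos v) (P.pos w) ↔
      p ∈ segment ℝ (P.center v) (P.center w) := by
    intro v w
    have h := image_segment ℝ planeEquiv.toLinearEquiv.toLinearMap.toAffineMap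
      (P.center v) (P.center w)
    change planeEquiv '' _ = segment ℝ (P.pos v) (P.pos w) at h
    rw [← h, planeEquiv.injective.mem_set_image]
  simp only [net, skeleton, Set.mem_ofPred_eq, Set.mem_union, hseg]
  refine ⟨Or.inr, ?_⟩
  rintro (⟨v, rfl⟩ | h)
  · obtain ⟨d, rfl⟩ := exists_dart_fst hconn v
    exact ⟨d.fst, d.snd, d.adj, left_mem_segment _ _ _⟩
  · exact h

theorem faceBound_of_facialDegree_le [Infinite V] (hconn : P.graph.Connected) {D : ℕ}
    (hD : ∀ σ ∈ P.faces, P.facialDegree σ ≤ (D : ℕ∞)) : P.FaceBound D := by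
  intro d
  have hnet : planeEquiv.symm '' P.netᶜ = P.skeletonᶜ := by
    rw [Set.image_compl_eq planeEquiv.symm.bijective]
    ext p
    rw [Set.mem_compl_iff, Set.mem_compl_iff, ← P.planeEquiv_mem_net_iff hconn,
      ← planeEquiv.symm.injective.mem_set_image, planeEquiv.symm_apply_apply]
  have himage : planeEquiv.symm '' P.faceOf d =
      connectedComponentIn P.skeletonᶜ (planeEquiv.symm (P.sectorPt d)) := by
    rw [faceOf, ← hnet]
    exact planeEquiv.symm.toHomeomorph.image_connectedComponentIn (P.sectorPt_notMem_net d)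
  have hface : planeEquiv.symm '' P.faceOf d ∈ P.faces :=
    ⟨_, hnet ▸ Set.mem_image_of_mem _ (P.sectorPt_notMem_net d), himage⟩
  refine (Set.encard_le_encard ?_).trans
    ((Set.encard_image_le Prod.fst (P.corners _)).trans (hD _ hface))
  rintro v ⟨q, hq, hqv⟩
  have hskel : planeEquiv.symm q ∈ P.skeletonᶜ :=
    hnet ▸ Set.mem_image_of_mem _ (P.faceOf_subset d hq)
  have hdisk : planeEquiv.symm q ∈ P.disk v := by
    rw [disk, Metric.mem_ball, ← planeEquiv.dist_map, planeEquiv.apply_symm_apply, dist_eq_norm]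
    exact hqv
  refine ⟨(v, connectedComponentIn (P.disk v \ P.skeleton) (planeEquiv.symm q)),
    ⟨⟨_, ⟨hdisk, hskel⟩, rfl⟩, ?_⟩, rfl⟩
  have hq' : planeEquiv.symm q ∈ connectedComponentIn P.skeletonᶜ _ :=
    himage ▸ Set.mem_image_of_mem _ hq
  rw [himage, connectedComponentIn_eq hq']
  exact connectedComponentIn_mono _ fun x hx => hx.2

theorem norm_pos_sub_le_dist (hconn : P.graph.Connected) (v w : V) :
    ‖P.pos v - P.pos w‖ ≤ P.graph.dist v w := by
  obtain ⟨p, hp⟩ := hconn.exists_walk_length_eq_dist v w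
  have h := le_length_nsmul (δ := fun a b => ‖P.pos a - P.pos b‖) (N := 1) (by simp)
    (fun a b c => norm_sub_le_norm_sub_add_norm_sub _ _ _)
    (fun a b hab => (P.norm_of_adj hab.symm).le) p
  rwa [hp, nsmul_one] at h

theorem card_darts_le {v : V} {s : Finset P.graph.Dart} (hs : ∀ d ∈ s, d.fst = v) :
    s.card ≤ 9 := by
  classical
  have hinj : Set.InjOn (fun d : P.graph.Dart => d.snd) s := fun d hd e he h =>
    SimpleGraph.Dart.ext _ _ (Prod.ext ((hs d hd).trans (hs e he).symm) h)
  have hcard := P.card_le (s := s.image fun d => d.snd) (z := P.pos v) zero_le_one (by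
    intro w hw
    obtain ⟨d, hd, rfl⟩ := Finset.mem_image.1 hw
    exact hs d hd ▸ (P.norm_dir d).le)
  rw [Finset.card_image_of_injOn hinj] at hcard
  norm_num only at hcard
  exact_mod_cast hcard

theorem faceOf_iterate_facePred (d : P.graph.Dart) (k : ℕ) :
    P.faceOf (P.facePred^[k] d) = P.faceOf d := by
  induction k with
  | zero => rfl
  | succ k ih => rw [Function.iterate_succ_apply', faceOf_facePred, ih]

theorem dist_iterate_facePred_le (hconn : P.graph.Connected) (d : P.graph.Dart) (k : ℕ) :
    P.graph.dist d.fst (P.facePred^[k] d).fst ≤ k := by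
  induction k with
  | zero => simp
  | succ k ih =>
    rw [Function.iterate_succ_apply']
    have hadj := (P.facePred (P.facePred^[k] d)).adj
    rw [facePred_snd] at hadj
    exact hconn.dist_triangle.trans
      (add_le_add ih (SimpleGraph.dist_eq_one_iff_adj.2 hadj.symm).le)

variable {P} {D : ℕ}

theorem FaceBound.exists_orbit (hD : P.FaceBound D) (d : P.graph.Dart) :
    ∃ O : Finset P.graph.Dart, d ∈ O ∧ O.card ≤ 9 * D ∧ (∀ e, P.facePred e ∈ O ↔ e ∈ O) ∧
      ∀ e ∈ O, ∃ k < O.card, P.facePred^[k] d = e := by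
  classical
  set T : Set V := {v | ∃ q ∈ P.faceOf d, ‖q - P.pos v‖ < 1 / 2} with hT
  have hfin : T.Finite := Set.finite_of_encard_le_coe (hD d)
  have hTcard : hfin.toFinset.card ≤ D := by
    have h := hD d
    rw [← hT, hfin.encard_eq_coe_toFinset_card] at h
    exact_mod_cast h
  have hdarts : {e : P.graph.Dart | e.fst ∈ T}.Finite :=
    (hfin.biUnion fun v _ => P.finite_darts v).subset fun e he => Set.mem_biUnion he rfl
  have hmem : ∀ k, (P.facePred^[k] d).fst ∈ T := by
    refine fun k => ⟨_, P.faceOf_iterate_facePred d k ▸ P.sectorPt_mem_faceOf _, ?_⟩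
    rw [sectorPt, P.norm_polarPt_sub _ (by norm_num)]
    norm_num
  obtain ⟨O, hd, hsub, hO, hk⟩ := exists_finset_orbit P.facePred_injective hdarts hmem
  have himage : O.image (fun e => e.fst) ⊆ hfin.toFinset :=
    Finset.image_subset_iff.2 fun e he => hfin.mem_toFinset.2 (hsub he)
  refine ⟨O, hd, ?_, hO, hk⟩
  calc O.card ≤ 9 * (O.image fun e => e.fst).card :=
        Finset.card_le_mul_card_image O 9 fun v _ =>
          P.card_darts_le (v := v) fun e he => (Finset.mem_filter.1 he).2
    _ ≤ 9 * D := by gcongr; exact (Finset.card_le_card himage).trans hTcard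

theorem FaceBound.dist_le [Infinite V] (hD : P.FaceBound D) (hconn : P.graph.Connected)
    {d e : P.graph.Dart} (h : P.faceOf d = P.faceOf e) : P.graph.dist d.fst e.fst ≤ 9 * D := by
  obtain ⟨O, hd, hcard, hO, hk⟩ := hD.exists_orbit d
  obtain ⟨k, hkO, rfl⟩ := hk e (mem_of_faceOf_eq hconn hO h hd)
  exact (P.dist_iterate_facePred_le hconn d k).trans (hkO.le.trans hcard)

theorem FaceBound.norm_sub_le [Infinite V] (hD : P.FaceBound D) (hconn : P.graph.Connected)
    {d : P.graph.Dart} {q : ℂ} (h : q ∈ P.faceOf d) : ‖P.pos d.fst - q‖ ≤ 18 * D + 2 := by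
  obtain ⟨O, hd, hcard, hO, hk⟩ := hD.exists_orbit d
  obtain ⟨e, he, hnear⟩ := exists_near_of_mem_faceOf hconn hO hd h
  obtain ⟨k, hkO, rfl⟩ := hk e he
  have hdist : ‖P.pos d.fst - P.pos (P.facePred^[k] d).fst‖ ≤ O.card :=
    (P.norm_pos_sub_le_dist hconn _ _).trans
      (Nat.cast_le.2 ((P.dist_iterate_facePred_le hconn d k).trans hkO.le))
  have hcard' : (O.card : ℝ) ≤ 9 * D := by exact_mod_cast hcard
  linarith [norm_sub_le_norm_sub_add_norm_sub (P.pos d.fst) (P.pos (P.facePred^[k] d).fst) q]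

/-! ### The vertices around a point of the plane -/

variable (P) in
/-- The vertices on the boundary of the face of `q`, and those at distance less than `3/4`. The
second clause makes the notion meaningful on the net itself. -/
def around (q : ℂ) : Set V :=
  {a | (∃ d : P.graph.Dart, d.fst = a ∧ q ∈ P.faceOf d) ∨ ‖q - P.pos a‖ < 3 / 4}

theorem mem_around_iff_of_mem_net {q : ℂ} (hq : q ∈ P.net) {a : V} :
    a ∈ P.around q ↔ ‖q - P.pos a‖ < 3 / 4 :=
  or_iff_right fun ⟨d, _, h⟩ => P.faceOf_subset d h hq

theorem exists_norm_sub_le_half {p : ℂ} (hp : p ∈ P.net) : ∃ a, ‖p - P.pos a‖ ≤ 1 / 2 := by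
  obtain ⟨v, w, h, s, t, hs, ht, hst, rfl⟩ := hp
  obtain rfl : s = 1 - t := by linarith
  have hv : ‖(1 - t) • P.pos v + t • P.pos w - P.pos v‖ = t := by
    rw [show (1 - t) • P.pos v + t • P.pos w - P.pos v = t • (P.pos w - P.pos v) by module,
      norm_smul, P.norm_of_adj h, Real.norm_of_nonneg ht, mul_one]
  have hw : ‖(1 - t) • P.pos v + t • P.pos w - P.pos w‖ = 1 - t := by
    rw [show (1 - t) • P.pos v + t • P.pos w - P.pos w = (1 - t) • (P.pos v - P.pos w) by module,
      norm_smul, P.norm_of_adj h.symm, Real.norm_of_nonneg hs, mul_one]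
  rcases le_total t (1 / 2) with ht2 | ht2
  · exact ⟨v, hv.trans_le ht2⟩
  · exact ⟨w, hw.trans_le (by linarith)⟩

variable [Infinite V]

theorem mem_around_iff (hconn : P.graph.Connected) {q : ℂ} (hq : q ∉ P.net) {a : V} :
    a ∈ P.around q ↔ ∃ d : P.graph.Dart, d.fst = a ∧ q ∈ P.faceOf d := by
  refine or_iff_left_of_imp fun hqa => ?_
  obtain ⟨e, rfl⟩ := exists_dart_fst hconn a
  obtain ⟨d, hd, hqd⟩ := P.exists_mem_sector e.adj hq hqa
  exact ⟨d, hd, P.sector_subset_faceOf d hqd⟩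

theorem around_subset_of_isPreconnected (hconn : P.graph.Connected) {S : Set ℂ}
    (hS : IsPreconnected S) (hnet : S ⊆ P.netᶜ) {p q : ℂ} (hp : p ∈ S) (hq : q ∈ S) :
    P.around p ⊆ P.around q := by
  intro a ha
  obtain ⟨d, rfl, hd⟩ := (mem_around_iff hconn (hnet hp)).1 ha
  refine Or.inl ⟨d, rfl, ?_⟩
  rw [P.faceOf_eq_of_mem hd]
  exact hS.subset_connectedComponentIn hp hnet hq

theorem around_nonempty (hconn : P.graph.Connected) (q : ℂ) : (P.around q).Nonempty := by
  by_cases hq : q ∈ P.net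
  · obtain ⟨a, ha⟩ := exists_norm_sub_le_half hq
    exact ⟨a, Or.inr (by linarith)⟩
  obtain ⟨v⟩ := hconn.nonempty
  obtain ⟨d, -⟩ := exists_dart_fst hconn v
  obtain ⟨p, hp, hdist⟩ := P.isClosed_net.exists_infDist_eq_dist
    ⟨_, d.fst, d.snd, d.adj, left_mem_segment _ _ _⟩ q
  -- The open ball around `q` up to the nearest point `p` of the net lies in the face of `q`.
  have hball : Metric.ball q (Metric.infDist q P.net) ⊆ P.netᶜ :=
    Set.subset_compl_iff_disjoint_right.2 Metric.disjoint_ball_infDist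
  have hpos : 0 < Metric.infDist q P.net := hdist ▸ _root_.dist_pos.2 fun h => hq (h ▸ hp)
  have hclosure : p ∈ closure (Metric.ball q (Metric.infDist q P.net)) := by
    rw [closure_ball q hpos.ne', hdist, Metric.mem_closedBall, dist_comm]
  obtain ⟨x, hx, hpx⟩ := Metric.mem_closure_iff.1 hclosure (1 / 4) (by norm_num)
  obtain ⟨a, ha⟩ := exists_norm_sub_le_half hp
  have hax : a ∈ P.around x := by
    refine Or.inr ?_
    rw [dist_comm, dist_eq_norm] at hpx
    linarith [norm_sub_le_norm_sub_add_norm_sub x p (P.pos a)]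
  exact ⟨a, around_subset_of_isPreconnected hconn (convex_ball _ _).isPreconnected hball hx
    (Metric.mem_ball_self hpos) hax⟩

theorem eventually_around (hconn : P.graph.Connected) (p : ℂ) :
    ∀ᶠ q in 𝓝 p, (P.around p ∩ P.around q).Nonempty := by
  by_cases hp : p ∈ P.net
  · obtain ⟨a, ha⟩ := exists_norm_sub_le_half hp
    filter_upwards [Metric.ball_mem_nhds p (show (0 : ℝ) < 1 / 4 by norm_num)] with q hq
    refine ⟨a, Or.inr (by linarith), Or.inr ?_⟩
    rw [mem_ball_iff_norm] at hq
    linarith [norm_sub_le_norm_sub_add_norm_sub q p (P.pos a)]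
  · obtain ⟨r, hr, hsub⟩ := Metric.isOpen_iff.1 P.isClosed_net.isOpen_compl p hp
    obtain ⟨a, ha⟩ := around_nonempty hconn p
    filter_upwards [Metric.ball_mem_nhds p hr] with q hq
    exact ⟨a, ha, around_subset_of_isPreconnected hconn (convex_ball p r).isPreconnected hsub
      (Metric.mem_ball_self hr) hq ha⟩

theorem FaceBound.dist_le_of_mem_around (hD : P.FaceBound D) (hconn : P.graph.Connected) {q : ℂ}
    {a b : V} (ha : a ∈ P.around q) (hb : b ∈ P.around q) : P.graph.dist a b ≤ 9 * D + 1 := by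
  by_cases hq : q ∈ P.net
  · rw [mem_around_iff_of_mem_net hq] at ha hb
    obtain ⟨v, w, h, hmem⟩ := hq
    have hvw := SimpleGraph.dist_eq_one_iff_adj.2 h
    have hwv := SimpleGraph.dist_eq_one_iff_adj.2 h.symm
    rcases P.eq_or_eq_of_mem_segment h hmem ha with rfl | rfl <;>
      rcases P.eq_or_eq_of_mem_segment h hmem hb with rfl | rfl <;>
      simp [hvw, hwv]
  · obtain ⟨d, rfl, hd⟩ := (mem_around_iff hconn hq).1 ha
    obtain ⟨e, rfl, he⟩ := (mem_around_iff hconn hq).1 hb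
    exact (hD.dist_le hconn (P.faceOf_eq_of_mem_of_mem hd he)).trans (Nat.le_succ _)

theorem FaceBound.norm_sub_le_of_mem_around (hD : P.FaceBound D) (hconn : P.graph.Connected)
    {q : ℂ} {a : V} (ha : a ∈ P.around q) : ‖P.pos a - q‖ ≤ 18 * D + 2 := by
  rcases ha with ⟨d, rfl, hd⟩ | h
  · exact hD.norm_sub_le hconn hd
  · rw [norm_sub_rev]
    linarith [(Nat.cast_nonneg D : (0 : ℝ) ≤ D)]

theorem reachable_of_isPreconnected (hconn : P.graph.Connected) {S : Set ℂ}
    (hS : IsPreconnected S) {U : Set V} (hU : ∀ x ∈ S, P.around x ⊆ U) {H : SimpleGraph U}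
    (hH : ∀ x, ∀ a b : U, ↑a ∈ P.around x → ↑b ∈ P.around x → H.Reachable a b) {p q : ℂ}
    (hp : p ∈ S) (hq : q ∈ S) {a b : U} (ha : ↑a ∈ P.around p) (hb : ↑b ∈ P.around q) :
    H.Reachable a b := by
  refine hS.induction₂ (fun x y => ∀ a b : U, ↑a ∈ P.around x → ↑b ∈ P.around y →
    H.Reachable a b) (fun x hx => ?_) (fun x y z _ hy _ hxy hyz a b ha hb => ?_)
    (fun x y _ _ hxy a b ha hb => (hxy b a hb ha).symm) hp hq a b ha hb
  · filter_upwards [nhdsWithin_le_nhds (eventually_around hconn x)] with y ⟨c, hcx, hcy⟩ a b ha hb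
    exact (hH x a ⟨c, hU x hx hcx⟩ ha hcx).trans (hH y _ b hcy hb)
  · obtain ⟨c, hc⟩ := around_nonempty hconn y
    exact (hxy a ⟨c, hU y hy hc⟩ ha hc).trans (hyz _ b hc hb)

theorem FaceBound.dist_le_of_near (hD : P.FaceBound D) (hconn : P.graph.Connected) {p q : ℂ}
    (hpq : ‖p - q‖ ≤ 2) {a b : V} (ha : a ∈ P.around p) (hb : b ∈ P.around q) :
    P.graph.dist a b ≤ (36 * D + 9) ^ 2 * (9 * D + 1) := by
  have hfin := P.finite_norm_pos_sub_le p (18 * D + 4)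
  set U : Set V := {v | ‖P.pos v - p‖ ≤ 18 * D + 4}
  let _ : Fintype U := hfin.fintype
  have hU : ∀ x ∈ segment ℝ p q, P.around x ⊆ U := by
    intro x hx a ha
    have hxp : ‖x - p‖ ≤ 2 := (norm_sub_le_of_mem_segment hx).trans (norm_sub_rev q p ▸ hpq)
    have hax := hD.norm_sub_le_of_mem_around hconn ha
    rw [Set.mem_ofPred_eq]
    linarith [norm_sub_le_norm_sub_add_norm_sub (P.pos a) x p]
  -- A path that links vertices around common points visits every vertex near the segment at most
  -- once, so packing bounds its length.
  let H : SimpleGraph U := SimpleGraph.fromRel fun a b => ∃ x, ↑a ∈ P.around x ∧ ↑b ∈ P.around x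
  have hH : ∀ x, ∀ a b : U, ↑a ∈ P.around x → ↑b ∈ P.around x → H.Reachable a b := by
    intro x a b ha hb
    by_cases hab : a = b
    · exact hab ▸ .rfl
    · exact ((SimpleGraph.fromRel_adj _ a b).2 ⟨hab, Or.inl ⟨x, ha, hb⟩⟩).reachable
  have hp := left_mem_segment ℝ p q
  have hq := right_mem_segment ℝ p q
  have hreach := reachable_of_isPreconnected hconn (convex_segment p q).isPreconnected hU hH hp hq
    (a := ⟨a, hU p hp ha⟩) (b := ⟨b, hU q hq hb⟩) ha hb
  have hcard : Fintype.card U ≤ (36 * D + 9) ^ 2 := by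
    have h := P.card_le (z := p) (r := 18 * D + 4) (s := U.toFinset) (by positivity)
      fun v hv => (Set.mem_toFinset.1 hv : v ∈ U)
    rw [show 2 * (18 * (D : ℝ) + 4) + 1 = (36 * D + 9 : ℕ) by push_cast; ring,
      Set.toFinset_card] at h
    exact_mod_cast h
  have hdist := le_card_nsmul (δ := fun a b : U => P.graph.dist (a : V) b)
    (fun a => P.graph.dist_self.le) (fun _ _ _ => hconn.dist_triangle) (Nat.zero_le (9 * D + 1))
    (fun a b hab => by
      obtain ⟨-, ⟨x, ha, hb⟩ | ⟨x, hb, ha⟩⟩ := (SimpleGraph.fromRel_adj _ a b).1 hab <;>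
      exact hD.dist_le_of_mem_around hconn ha hb) hreach
  rw [smul_eq_mul] at hdist
  exact hdist.trans (Nat.mul_le_mul_right _ hcard)

end PennyConfiguration

/-! ### Sums of squared differences -/

section Sums

variable {ι : Type*}

theorem sq_sub_le_mul_sum_of_injOn {u : ℕ → ℝ} {m : ℕ} {e : ℕ → ι} {s : Finset ι} {g : ι → ℝ}
    (hg : ∀ i ∈ s, 0 ≤ g i) (he : Set.InjOn e (Set.Iio m)) (hs : ∀ k < m, e k ∈ s)
    (hu : ∀ k < m, (u (k + 1) - u k) ^ 2 ≤ g (e k)) : (u m - u 0) ^ 2 ≤ m * ∑ i ∈ s, g i := by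
  classical
  have he' : Set.InjOn e (Finset.range m) := by rwa [Finset.coe_range]
  calc (u m - u 0) ^ 2 = (∑ k ∈ Finset.range m, (u (k + 1) - u k)) ^ 2 := by
        rw [Finset.sum_range_sub]
    _ ≤ m * ∑ k ∈ Finset.range m, (u (k + 1) - u k) ^ 2 := by
        simpa only [Finset.card_range] using sq_sum_le_card_mul_sum_sq (s := Finset.range m)
    _ ≤ m * ∑ k ∈ Finset.range m, g (e k) := by
        gcongr with k hk
        exact hu k (Finset.mem_range.1 hk)
    _ = m * ∑ i ∈ (Finset.range m).image e, g i := by rw [Finset.sum_image he']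
    _ ≤ m * ∑ i ∈ s, g i := by
        gcongr
        · exact fun i hi _ => hg i hi
        · exact Finset.image_subset_iff.2 fun k hk => hs k (Finset.mem_range.1 hk)

theorem sq_sub_le_sum_steps (g : ℤ → ℝ) {a b s t : ℤ} (hs : s ∈ Finset.Icc a b)
    (ht : t ∈ Finset.Icc a b) :
    (g s - g t) ^ 2 ≤ (Finset.Icc a b).card * ∑ k ∈ Finset.Icc a b, (g (k + 1) - g k) ^ 2 := by
  wlog hst : s ≤ t generalizing s t
  · rw [sub_sq_comm]
    exact this ht hs (le_of_not_ge hst)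
  rw [Finset.mem_Icc] at hs ht
  obtain ⟨m, rfl⟩ := Int.le.dest hst
  have h := sq_sub_le_mul_sum_of_injOn (u := fun k => g (s + k)) (m := m) (e := fun k => s + k)
    (s := Finset.Icc a b) (g := fun k => (g (k + 1) - g k) ^ 2) (fun _ _ => sq_nonneg _)
    (fun k _ l _ hkl => by simpa using hkl) (fun k hk => Finset.mem_Icc.2 (by lia))
    (fun k _ => by rw [Nat.cast_add_one, ← add_assoc])
  rw [Nat.cast_zero, add_zero] at h
  rw [sub_sq_comm]
  refine h.trans ?_
  have hm : m ≤ (Finset.Icc a b).card := by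
    rw [Int.card_Icc]
    lia
  gcongr

theorem sum_sq_sub_le_grid (F : ℤ × ℤ → ℝ) {a b a' b' : ℤ} {X Y : Finset ℤ}
    (hX : X = Finset.Icc a b) (hY : Y = Finset.Icc a' b') :
    ∑ i ∈ X ×ˢ Y, ∑ j ∈ X ×ˢ Y, (F i - F j) ^ 2 ≤
      2 * X.card ^ 3 * Y.card * ∑ i ∈ X ×ˢ Y, (F (i.1 + 1, i.2) - F i) ^ 2 +
      2 * X.card * Y.card ^ 3 * ∑ i ∈ X ×ˢ Y, (F (i.1, i.2 + 1) - F i) ^ 2 := by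
  have hstep : ∀ i ∈ X ×ˢ Y, ∀ j ∈ X ×ˢ Y, (F i - F j) ^ 2 ≤
      2 * (X.card * ∑ k ∈ X, (F (k + 1, i.2) - F (k, i.2)) ^ 2) +
      2 * (Y.card * ∑ k ∈ Y, (F (j.1, k + 1) - F (j.1, k)) ^ 2) := by
    intro i hi j hj
    subst hX hY
    rw [Finset.mem_product] at hi hj
    have h₁ := sq_sub_le_sum_steps (fun k => F (k, i.2)) hi.1 hj.1
    have h₂ := sq_sub_le_sum_steps (fun k => F (j.1, k)) hi.2 hj.2
    have h₃ := add_sq_le (a := F i - F (j.1, i.2)) (b := F (j.1, i.2) - F j)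
    rw [sub_add_sub_cancel] at h₃
    linarith
  refine (Finset.sum_le_sum fun i hi => Finset.sum_le_sum fun j hj => hstep i hi j hj).trans_eq ?_
  simp only [Finset.sum_add_distrib, Finset.sum_const, Finset.card_product,
    nsmul_eq_mul, ← Finset.mul_sum, Finset.sum_product, Nat.cast_mul]
  rw [Finset.sum_comm (s := Y) (t := X)]
  ring

open Finset BigOperators

theorem sq_sub_expect_le {s : Finset ι} (hs : s.Nonempty) (f : ι → ℝ) (a : ℝ) :
    (a - 𝔼 u ∈ s, f u) ^ 2 ≤ 𝔼 u ∈ s, (a - f u) ^ 2 := by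
  have h := expect_mul_sq_le_sq_mul_sq s (fun u => a - f u) 1
  simpa only [expect_sub_distrib, expect_const hs, Pi.one_apply, mul_one, one_pow] using h

theorem sq_expect_sub_expect_le {s t : Finset ι} (hs : s.Nonempty) (ht : t.Nonempty)
    (f : ι → ℝ) : (𝔼 u ∈ s, f u - 𝔼 w ∈ t, f w) ^ 2 ≤ 𝔼 u ∈ s, 𝔼 w ∈ t, (f u - f w) ^ 2 := by
  rw [sub_sq_comm]
  refine (sq_sub_expect_le hs f _).trans (expect_le_expect fun u _ => ?_)
  rw [sub_sq_comm]
  exact sq_sub_expect_le ht f (f u)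

theorem sum_sq_sub_expect_le (s : Finset ι) (f : ι → ℝ) (a : ℝ) :
    ∑ u ∈ s, (f u - 𝔼 w ∈ s, f w) ^ 2 ≤ ∑ u ∈ s, (f u - a) ^ 2 := by
  set m := 𝔼 w ∈ s, f w
  have hm : ∑ u ∈ s, f u = #s * m := (card_mul_expect s f).symm
  have hexpand : ∀ u, (f u - a) ^ 2 = (f u - m) ^ 2 + (2 * (m - a) * f u + (a ^ 2 - m ^ 2)) :=
    fun u => by ring
  have hsum : ∑ u ∈ s, (2 * (m - a) * f u + (a ^ 2 - m ^ 2)) = #s * (m - a) ^ 2 := by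
    rw [sum_add_distrib, ← mul_sum, hm, sum_const, nsmul_eq_mul]
    ring
  simp only [hexpand]
  rw [sum_add_distrib, hsum]
  exact le_add_of_nonneg_right (by positivity)

theorem sum_sum_sq_sub_le (s : Finset ι) (f g : ι → ℝ) :
    ∑ y ∈ s, ∑ z ∈ s, (f y - f z) ^ 2 ≤
      6 * #s * ∑ y ∈ s, (f y - g y) ^ 2 + 3 * ∑ y ∈ s, ∑ z ∈ s, (g y - g z) ^ 2 := by
  have hsq : ∀ y z, (f y - f z) ^ 2 ≤
      3 * ((f y - g y) ^ 2 + (f z - g z) ^ 2 + (g y - g z) ^ 2) := fun y z => by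
    nlinarith [sq_nonneg (f y - g y + (f z - g z)), sq_nonneg (f y - g y - (g y - g z)),
      sq_nonneg (f z - g z + (g y - g z))]
  refine (sum_le_sum fun y _ => sum_le_sum fun z _ => hsq y z).trans_eq ?_
  simp only [← mul_sum, sum_add_distrib, sum_const, nsmul_eq_mul]
  ring

theorem expect_le_sum_div {s t : Finset ι} (hst : s ⊆ t) {f : ι → ℝ} (hf : ∀ i ∈ t, 0 ≤ f i)
    {m : ℝ} (hm : 0 < m) (hms : m ≤ #s) : 𝔼 i ∈ s, f i ≤ (∑ i ∈ t, f i) / m := by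
  rw [expect_eq_sum_div_card]
  have := sum_le_sum_of_subset_of_nonneg hst fun i hi _ => hf i hi
  exact div_le_div₀ (sum_nonneg hf) this hm hms

end Sums

/-! ### Balls and Dirichlet energies -/

/-- A connected graph all of whose balls are finite. -/
structure FiniteBalls {V : Type*} (G : SimpleGraph V) : Prop where
  connected : G.Connected
  finite : ∀ (x : V) (R : ℝ), (G.metricBall x R).Finite

namespace FiniteBalls

open Finset BigOperators

variable {V : Type*} {G : SimpleGraph V} (h : FiniteBalls G) (f : V → ℝ) {x y : V} {r R : ℝ}

/-- The combinatorial ball as a finite set. -/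
noncomputable def ball (x : V) (R : ℝ) : Finset V := (h.finite x R).toFinset

theorem mem_ball : y ∈ h.ball x R ↔ (G.dist y x : ℝ) ≤ R := by
  rw [ball, Set.Finite.mem_toFinset]
  exact and_iff_right (h.connected.preconnected y x)

theorem ball_nonempty (x : V) (hR : 0 ≤ R) : (h.ball x R).Nonempty :=
  ⟨x, by rwa [h.mem_ball, SimpleGraph.dist_self, Nat.cast_zero]⟩

theorem ncard_metricBall (x : V) (R : ℝ) : (G.metricBall x R).ncard = #(h.ball x R) :=
  Set.ncard_eq_toFinset_card _ _

theorem dist_triangle (h : FiniteBalls G) (u v w : V) :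
    (G.dist u w : ℝ) ≤ G.dist u v + G.dist v w := by
  exact_mod_cast h.connected.dist_triangle

theorem ball_subset (hr : G.dist y x + r ≤ R) : h.ball y r ⊆ h.ball x R := by
  intro z hz
  rw [h.mem_ball] at hz ⊢
  linarith [h.dist_triangle z y x]

theorem ball_mono (x : V) (hr : r ≤ R) : h.ball x r ⊆ h.ball x R :=
  h.ball_subset (by simpa)

theorem card_ball_le_card_ball (hr : G.dist y x + r ≤ R) :
    (#(h.ball y r) : ℝ) ≤ #(h.ball x R) :=
  Nat.cast_le.2 (card_le_card (h.ball_subset hr))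

theorem finite_ballEdges (h : FiniteBalls G) (x : V) (R : ℝ) : (G.ballEdges x R).Finite :=
  ((h.finite x R).prod (h.finite x R)).subset fun _ hp => ⟨hp.1, hp.2.1⟩

/-- The ordered pairs of adjacent vertices of a combinatorial ball, as a finite set. -/
noncomputable def edges (x : V) (R : ℝ) : Finset (V × V) := (h.finite_ballEdges x R).toFinset

theorem mem_edges {p : V × V} :
    p ∈ h.edges x R ↔ p.1 ∈ h.ball x R ∧ p.2 ∈ h.ball x R ∧ G.Adj p.1 p.2 := by
  rw [edges, ball, Set.Finite.mem_toFinset, Set.Finite.mem_toFinset, Set.Finite.mem_toFinset]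
  rfl

theorem edges_subset (hr : G.dist y x + r ≤ R) : h.edges y r ⊆ h.edges x R := by
  intro p hp
  rw [h.mem_edges] at hp ⊢
  exact ⟨h.ball_subset hr hp.1, h.ball_subset hr hp.2.1, hp.2.2⟩

/-- The Dirichlet energy of `f` in a ball; every edge of the ball is counted in both
directions. -/
noncomputable def energy (x : V) (R : ℝ) : ℝ := ∑ p ∈ h.edges x R, (f p.1 - f p.2) ^ 2

theorem energy_nonneg (x : V) (R : ℝ) : 0 ≤ h.energy f x R :=
  sum_nonneg fun _ _ => sq_nonneg _

theorem energy_le_energy (hr : G.dist y x + r ≤ R) : h.energy f y r ≤ h.energy f x R :=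
  sum_le_sum_of_subset_of_nonneg (h.edges_subset hr) fun _ _ _ => sq_nonneg _

theorem energy_mono (x : V) (hr : r ≤ R) : h.energy f x r ≤ h.energy f x R :=
  h.energy_le_energy f (by simpa)

theorem sq_sub_le_dist_mul_energy (a b : V) :
    (f a - f b) ^ 2 ≤ G.dist a b * h.energy f a (G.dist a b) := by
  obtain ⟨p, hp, hlen⟩ := h.connected.exists_path_of_dist a b
  have hball : ∀ k ≤ p.length, p.getVert k ∈ h.ball a (G.dist a b) := by
    intro k hk
    rw [h.mem_ball, G.dist_comm]
    have hdist := G.dist_le (p.take k)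
    rw [SimpleGraph.Walk.take_length, min_eq_left hk] at hdist
    exact_mod_cast hlen ▸ hdist.trans hk
  have hinj : Set.InjOn (fun k => (p.getVert (k + 1), p.getVert k)) (Set.Iio p.length) :=
    fun k hk l hl hkl => hp.getVert_injOn (Set.mem_Iio.1 hk).le (Set.mem_Iio.1 hl).le
      (Prod.mk.inj hkl).2
  have htele := sq_sub_le_mul_sum_of_injOn (u := fun k => f (p.getVert k)) (m := p.length)
    (s := h.edges a (G.dist a b)) (g := fun q => (f q.1 - f q.2) ^ 2) (fun _ _ => sq_nonneg _) hinj
    (fun k hk => h.mem_edges.2 ⟨hball _ hk, hball _ hk.le, (p.adj_getVert_succ hk).symm⟩)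
    (fun k _ => le_rfl)
  rw [p.getVert_length, p.getVert_zero, hlen] at htele
  rwa [sub_sq_comm]

theorem sq_sub_le_mul_energy {a b : V} {n : ℕ} (hab : G.dist a b ≤ n) :
    (f a - f b) ^ 2 ≤ n * h.energy f a n := by
  have hab' : (G.dist a b : ℝ) ≤ n := by exact_mod_cast hab
  exact (h.sq_sub_le_dist_mul_energy f a b).trans
    (mul_le_mul hab' (h.energy_mono f a hab') (h.energy_nonneg f a _) n.cast_nonneg)

open Classical in
theorem sum_energy_le {ι : Type*} (I : Finset ι) (g : ι → V) {M : ℝ}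
    (hR : ∀ i ∈ I, G.dist (g i) x + r ≤ R)
    (hM : ∀ u : V, (#{i ∈ I | (G.dist u (g i) : ℝ) ≤ r} : ℝ) ≤ M) :
    ∑ i ∈ I, h.energy f (g i) r ≤ M * h.energy f x R := by
  have hext : ∀ i ∈ I, h.energy f (g i) r =
      ∑ p ∈ h.edges x R, if p ∈ h.edges (g i) r then (f p.1 - f p.2) ^ 2 else 0 := by
    intro i hi
    rw [← sum_filter, energy, filter_mem_eq_inter, inter_eq_right.2 (h.edges_subset (hR i hi))]
  rw [sum_congr rfl hext, sum_comm, energy, mul_sum]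
  refine sum_le_sum fun p _ => ?_
  rw [← sum_filter, sum_const, nsmul_eq_mul]
  refine mul_le_mul_of_nonneg_right (le_trans ?_ (hM p.1)) (sq_nonneg _)
  exact_mod_cast card_le_card (monotone_filter_right _ fun i _ hi =>
    h.mem_ball.1 (h.mem_edges.1 hi).1)

end FiniteBalls

/-! ### From a weak Poincaré inequality to the Poincaré inequality -/

section Steps

variable {V : Type*} {G : SimpleGraph V}

theorem exists_dist_le_and_dist_le_sub (hG : G.Connected) (y x : V) (s : ℕ) :
    ∃ z, G.dist y z ≤ s ∧ G.dist z x ≤ G.dist y x - s := by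
  obtain ⟨p, hp⟩ := hG.exists_walk_length_eq_dist y x
  refine ⟨p.getVert s, (G.dist_le (p.take s)).trans ?_, (G.dist_le (p.drop s)).trans ?_⟩
  · exact p.take_length s ▸ min_le_left _ _
  · rw [p.drop_length, hp]

theorem abs_sub_le_of_steps (hG : G.Connected) {A : V → ℝ} {x : V} {s : ℕ} {R Q : ℝ}
    (hQ : ∀ z z', (G.dist z x : ℝ) ≤ R → G.dist z z' ≤ s → |A z - A z'| ≤ Q) (J : ℕ) {y : V}
    (hy : (G.dist y x : ℝ) ≤ R) (hJ : G.dist y x ≤ J * s) : |A y - A x| ≤ J * Q := by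
  induction J generalizing y with
  | zero =>
    rw [zero_mul, Nat.le_zero, hG.dist_eq_zero_iff] at hJ
    simp [hJ]
  | succ J ih =>
    obtain ⟨z, hyz, hzx⟩ := exists_dist_le_and_dist_le_sub hG y x s
    have hle : (G.dist z x : ℝ) ≤ G.dist y x := by exact_mod_cast hzx.trans (Nat.sub_le _ _)
    have hz := ih (hle.trans hy) (by rw [add_mul, one_mul] at hJ; lia)
    have hstep := hQ y z hy hyz
    push_cast
    linarith [abs_sub_le (A y) (A z) (A x)]

end Steps

namespace FiniteBalls

open Finset BigOperators

variable {V : Type*} {G : SimpleGraph V} (h : FiniteBalls G) (f : V → ℝ) {x y z : V}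
  {r R m S C : ℝ}

/-- The sum of the squared differences of `f` over all ordered pairs of points of a ball. A weak
Poincaré inequality bounds it by the energy of `f` in a larger ball. -/
noncomputable def oscillation (x : V) (r : ℝ) : ℝ :=
  ∑ y ∈ h.ball x r, ∑ z ∈ h.ball x r, (f y - f z) ^ 2

open Classical in
theorem sum_card_mul_sum_le_sum_oscillation (x : V) (R r : ℝ) :
    ∑ y ∈ h.ball x R, #(h.ball y r) * ∑ u ∈ h.ball y r, (f y - f u) ^ 2 ≤
      ∑ w ∈ h.ball x (R + r), h.oscillation f w (2 * r) := by
  simp only [← nsmul_eq_mul, ← sum_const]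
  rw [sum_comm' (t' := h.ball x (R + r))
    (s' := fun w => {y ∈ h.ball x R | w ∈ h.ball y r})]
  · refine sum_le_sum fun w _ => ?_
    have hsub : ∀ y ∈ h.ball x R, w ∈ h.ball y r →
        y ∈ h.ball w (2 * r) ∧ h.ball y r ⊆ h.ball w (2 * r) := by
      intro y _ hw
      rw [h.mem_ball, G.dist_comm] at hw
      exact ⟨h.mem_ball.2 (by linarith [(Nat.cast_nonneg _).trans hw]),
        h.ball_subset (by linarith)⟩
    calc ∑ y ∈ h.ball x R with w ∈ h.ball y r, ∑ u ∈ h.ball y r, (f y - f u) ^ 2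
        ≤ ∑ y ∈ h.ball x R with w ∈ h.ball y r, ∑ u ∈ h.ball w (2 * r), (f y - f u) ^ 2 :=
          sum_le_sum fun y hy => sum_le_sum_of_subset_of_nonneg
            (hsub y (mem_filter.1 hy).1 (mem_filter.1 hy).2).2 fun _ _ _ => sq_nonneg _
      _ ≤ h.oscillation f w (2 * r) := sum_le_sum_of_subset_of_nonneg
            (fun y hy => (hsub y (mem_filter.1 hy).1 (mem_filter.1 hy).2).1)
            fun _ _ _ => sum_nonneg fun _ _ => sq_nonneg _
  · intro y w
    rw [mem_filter]
    refine ⟨fun ⟨hy, hw⟩ => ⟨⟨hy, hw⟩, ?_⟩, fun ⟨hy, _⟩ => hy⟩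
    rw [h.mem_ball] at hy hw ⊢
    linarith [h.dist_triangle w y x]

theorem sq_expect_sub_expect_le_oscillation (hm : 0 < m) (hy : m ≤ #(h.ball y r))
    (hz : m ≤ #(h.ball z r)) (hyz : G.dist z y ≤ r) :
    (𝔼 u ∈ h.ball y r, f u - 𝔼 w ∈ h.ball z r, f w) ^ 2 ≤ h.oscillation f y (2 * r) / m ^ 2 := by
  have hr : 0 ≤ r := (Nat.cast_nonneg _).trans hyz
  have hy' : h.ball y r ⊆ h.ball y (2 * r) := h.ball_mono y (by linarith)
  have hz' : h.ball z r ⊆ h.ball y (2 * r) := h.ball_subset (by linarith)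
  calc (𝔼 u ∈ h.ball y r, f u - 𝔼 w ∈ h.ball z r, f w) ^ 2
      ≤ 𝔼 u ∈ h.ball y r, 𝔼 w ∈ h.ball z r, (f u - f w) ^ 2 :=
        sq_expect_sub_expect_le (h.ball_nonempty y hr) (h.ball_nonempty z hr) f
    _ ≤ 𝔼 u ∈ h.ball y r, (∑ w ∈ h.ball y (2 * r), (f u - f w) ^ 2) / m :=
        expect_le_expect fun u _ => expect_le_sum_div hz' (fun _ _ => sq_nonneg _) hm hz
    _ ≤ (∑ u ∈ h.ball y (2 * r), (∑ w ∈ h.ball y (2 * r), (f u - f w) ^ 2) / m) / m :=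
        expect_le_sum_div hy' (fun _ _ => div_nonneg (sum_nonneg fun _ _ => sq_nonneg _) hm.le)
          hm hy
    _ = h.oscillation f y (2 * r) / m ^ 2 := by rw [← sum_div, div_div, ← sq, oscillation]

theorem sum_sq_sub_expect_le_sum_oscillation (hr : 0 ≤ r) (hm : 0 < m)
    (hball : ∀ y ∈ h.ball x R, m ≤ #(h.ball y r)) :
    ∑ y ∈ h.ball x R, (f y - 𝔼 u ∈ h.ball y r, f u) ^ 2 ≤
      (∑ w ∈ h.ball x (R + r), h.oscillation f w (2 * r)) / m ^ 2 := by
  rw [le_div_iff₀ (by positivity), sum_mul]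
  refine le_trans (sum_le_sum fun y hy => ?_) (h.sum_card_mul_sum_le_sum_oscillation f x R r)
  calc (f y - 𝔼 u ∈ h.ball y r, f u) ^ 2 * m ^ 2
      ≤ (𝔼 u ∈ h.ball y r, (f y - f u) ^ 2) * (#(h.ball y r)) ^ 2 := by
        gcongr
        · exact sq_sub_expect_le (h.ball_nonempty y hr) f (f y)
        · exact hball y hy
    _ = #(h.ball y r) * ∑ u ∈ h.ball y r, (f y - f u) ^ 2 := by
        rw [← card_mul_expect]
        ring

theorem sq_expect_sub_expect_le_of_oscillation_le (hr : 1 ≤ r) (hm : 0 < m) {J : ℕ}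
    (hJ : 2 * R ≤ J * r) (hball : ∀ z, G.dist z x ≤ R + r → m ≤ #(h.ball z r))
    (hS : ∀ w, G.dist w x ≤ R + r → h.oscillation f w (2 * r) ≤ S) (hy : G.dist y x ≤ R) :
    (𝔼 u ∈ h.ball y r, f u - 𝔼 w ∈ h.ball x r, f w) ^ 2 ≤ J ^ 2 * (S / m ^ 2) := by
  have hstep : ∀ z z', (G.dist z x : ℝ) ≤ R → G.dist z z' ≤ ⌊r⌋₊ →
      |𝔼 u ∈ h.ball z r, f u - 𝔼 w ∈ h.ball z' r, f w| ≤ √(S / m ^ 2) := by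
    intro z z' hz hzz'
    rw [Nat.le_floor_iff (by linarith), G.dist_comm] at hzz'
    have hz' := h.dist_triangle z' z x
    refine Real.abs_le_sqrt ((h.sq_expect_sub_expect_le_oscillation f hm (hball z (by linarith))
      (hball z' (by linarith)) hzz').trans ?_)
    gcongr
    exact hS z (by linarith)
  have hfloor : r ≤ 2 * ⌊r⌋₊ := by
    have h₁ : (1 : ℝ) ≤ ⌊r⌋₊ := by exact_mod_cast (Nat.one_le_floor_iff r).2 hr
    linarith [Nat.lt_floor_add_one r]
  have hdist : G.dist y x ≤ J * ⌊r⌋₊ := by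
    have : (J : ℝ) * r ≤ J * (2 * ⌊r⌋₊) := by gcongr
    have : (G.dist y x : ℝ) ≤ J * ⌊r⌋₊ := by linarith
    exact_mod_cast this
  have habs := abs_sub_le_of_steps h.connected hstep J hy hdist
  have hS0 : 0 ≤ S := (sum_nonneg fun _ _ => sum_nonneg fun _ _ => sq_nonneg _).trans
    (hS y (by linarith))
  calc _ ≤ (J * √(S / m ^ 2)) ^ 2 := sq_le_sq' (neg_le_of_abs_le habs) (le_of_abs_le habs)
    _ = J ^ 2 * (S / m ^ 2) := by rw [mul_pow, Real.sq_sqrt (by positivity)]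

theorem sum_sq_sub_expect_le_of_oscillation_le (hr : 1 ≤ r) (hrR : r ≤ R) (hm : 0 < m) {J : ℕ}
    (hJ : 2 * R ≤ J * r) (hball : ∀ z, G.dist z x ≤ R + r → m ≤ #(h.ball z r))
    (hS : ∀ w, G.dist w x ≤ R + r → h.oscillation f w (2 * r) ≤ S) :
    ∑ y ∈ h.ball x R, (f y - 𝔼 u ∈ h.ball x R, f u) ^ 2 ≤
      2 * (1 + J ^ 2) * #(h.ball x (2 * R)) * (S / m ^ 2) := by
  set A : V → ℝ := fun z => 𝔼 u ∈ h.ball z r, f u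
  have hS0 : 0 ≤ S := (sum_nonneg fun _ _ => sum_nonneg fun _ _ => sq_nonneg _).trans
    (hS x (by rw [G.dist_self, Nat.cast_zero]; linarith))
  have hnear : ∑ y ∈ h.ball x R, (f y - A y) ^ 2 ≤ #(h.ball x (2 * R)) * (S / m ^ 2) := by
    refine (h.sum_sq_sub_expect_le_sum_oscillation f (by linarith) hm fun y hy =>
      hball y (by linarith [h.mem_ball.1 hy])).trans ?_
    rw [← mul_div_assoc]
    gcongr
    refine (sum_le_card_nsmul _ _ S fun w hw => hS w (h.mem_ball.1 hw)).trans ?_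
    rw [nsmul_eq_mul]
    gcongr
    exact h.ball_mono x (by linarith)
  have hfar : ∑ y ∈ h.ball x R, (A y - A x) ^ 2 ≤
      #(h.ball x (2 * R)) * (J ^ 2 * (S / m ^ 2)) := by
    refine (sum_le_card_nsmul _ _ _ fun y hy => h.sq_expect_sub_expect_le_of_oscillation_le f hr hm
      hJ hball hS (h.mem_ball.1 hy)).trans ?_
    rw [nsmul_eq_mul]
    gcongr
    exact h.ball_mono x (by linarith)
  calc ∑ y ∈ h.ball x R, (f y - 𝔼 u ∈ h.ball x R, f u) ^ 2
      ≤ ∑ y ∈ h.ball x R, (f y - A x) ^ 2 := sum_sq_sub_expect_le _ f (A x)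
    _ ≤ ∑ y ∈ h.ball x R, 2 * ((f y - A y) ^ 2 + (A y - A x) ^ 2) :=
        sum_le_sum fun y _ => by
          simpa only [sub_add_sub_cancel] using add_sq_le (a := f y - A y) (b := A y - A x)
    _ = 2 * (∑ y ∈ h.ball x R, (f y - A y) ^ 2 + ∑ y ∈ h.ball x R, (A y - A x) ^ 2) := by
        rw [← mul_sum, sum_add_distrib]
    _ ≤ 2 * (#(h.ball x (2 * R)) * (S / m ^ 2) + #(h.ball x (2 * R)) * (J ^ 2 * (S / m ^ 2))) := by
        gcongr
    _ = _ := by ring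

theorem sum_sq_sub_expect_le_card_mul_energy (x : V) (R : ℝ) :
    ∑ y ∈ h.ball x R, (f y - 𝔼 u ∈ h.ball x R, f u) ^ 2 ≤
      #(h.ball x R) * (R ^ 2 * h.energy f x R) := by
  refine (sum_sq_sub_expect_le _ f (f x)).trans ?_
  rw [← nsmul_eq_mul]
  refine sum_le_card_nsmul _ _ _ fun y hy => ?_
  have hy' := h.mem_ball.1 hy
  rw [G.dist_comm] at hy'
  have hsq : (G.dist x y : ℝ) ≤ G.dist x y ^ 2 := by
    exact_mod_cast Nat.le_self_pow two_ne_zero _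
  rw [sub_sq_comm]
  refine (h.sq_sub_le_dist_mul_energy f x y).trans ?_
  gcongr
  · exact h.energy_nonneg f _ _
  · exact hsq.trans (by gcongr)
  · exact h.energy_mono f x hy'

theorem poincareWith_iff : G.PoincareWith C ↔ ∀ x R, 0 < R → ∀ f : V → ℝ,
    ∑ y ∈ h.ball x R, (f y - 𝔼 u ∈ h.ball x R, f u) ^ 2 ≤ C * R ^ 2 * h.energy f x (2 * R) := by
  have hmean : ∀ x R (f : V → ℝ), G.ballMean x R f = 𝔼 u ∈ h.ball x R, f u := by
    intro x R f
    rw [SimpleGraph.ballMean, h.ncard_metricBall, expect_eq_sum_div_card,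
      finsum_mem_eq_finite_toFinset_sum _ (h.finite x R), ball]
  unfold SimpleGraph.PoincareWith
  refine forall₃_congr fun x R _ => (and_iff_right (h.finite x _)).trans (forall_congr' fun f => ?_)
  rw [finsum_mem_eq_finite_toFinset_sum _ (h.finite x R),
    finsum_mem_eq_finite_toFinset_sum _ (h.finite_ballEdges x (2 * R))]
  simp only [sq_abs, hmean]
  rfl

theorem card_ball_two_pow_mul_le (hC : 0 ≤ C) (hvol : G.VolumeDoublingWith C) (x : V) (hr : 0 < r)
    (j : ℕ) : (#(h.ball x (2 ^ j * r)) : ℝ) ≤ C ^ j * #(h.ball x r) := by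
  induction j with
  | zero => simp
  | succ j ih =>
    have hj := (hvol x (2 ^ j * r) (by positivity)).2
    rw [h.ncard_metricBall, h.ncard_metricBall] at hj
    rw [pow_succ', pow_succ', mul_assoc, mul_assoc]
    exact hj.trans (mul_le_mul_of_nonneg_left ih hC)

theorem card_ball_le_pow_mul_card_ball (hC : 0 ≤ C) (hvol : G.VolumeDoublingWith C) (hr : 0 < r)
    {j : ℕ} (hz : G.dist x z + R ≤ 2 ^ j * r) :
    (#(h.ball x R) : ℝ) ≤ C ^ j * #(h.ball z r) :=
  (h.card_ball_le_card_ball hz).trans (h.card_ball_two_pow_mul_le hC hvol z hr j)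

theorem sum_sq_sub_expect_le_of_oscillation_le_energy {Cw : ℝ} {k : ℕ} (hC : 0 < C) (hCw : 0 ≤ Cw)
    (hvol : G.VolumeDoublingWith C)
    (hweak : ∀ w r, 1 ≤ r →
      h.oscillation f w r ≤ Cw * r ^ 2 * #(h.ball w r) * h.energy f w (2 ^ k * r))
    (hr : 1 ≤ r) (hR : R = 2 ^ (k + 2) * r) :
    ∑ y ∈ h.ball x R, (f y - 𝔼 u ∈ h.ball x R, f u) ^ 2 ≤
      8 * (1 + 2 ^ (2 * k + 6)) * C ^ (2 * k + 10) * Cw * R ^ 2 * h.energy f x (2 * R) := by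
  have hrR : 4 * r ≤ R := by
    rw [hR, pow_add]
    nlinarith [one_le_pow₀ (M₀ := ℝ) one_le_two (n := k)]
  set E := h.energy f x (2 * R)
  have hE : 0 ≤ E := h.energy_nonneg f _ _
  set N : ℝ := (#(h.ball x R) : ℝ)
  have hN : 0 < N := Nat.cast_pos.2 (h.ball_nonempty x (by linarith)).card_pos
  have hdouble : (#(h.ball x (2 * R)) : ℝ) ≤ C * N := by
    simpa using h.card_ball_two_pow_mul_le hC.le hvol x (r := R) (by linarith) 1
  have hball : ∀ z, G.dist z x ≤ R + r → N / C ^ (k + 4) ≤ #(h.ball z r) := by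
    intro z hz
    have hj : 2 ^ (k + 4) * r = 4 * R := by rw [hR]; ring
    rw [G.dist_comm] at hz
    exact (div_le_iff₀' (by positivity)).2
      (h.card_ball_le_pow_mul_card_ball hC.le hvol (by linarith) (by linarith))
  have hosc : ∀ w, G.dist w x ≤ R + r →
      h.oscillation f w (2 * r) ≤ Cw * (2 * r) ^ 2 * (C * N) * E := by
    intro w hw
    refine (hweak w (2 * r) (by linarith)).trans ?_
    have hk : 2 ^ k * (2 * r) = R / 2 := by rw [hR]; ring
    gcongr
    · exact h.energy_nonneg f _ _
    · exact (h.card_ball_le_card_ball (by linarith)).trans hdouble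
    · exact h.energy_le_energy f (by linarith)
  have hJ : 2 * R ≤ (2 ^ (k + 3) : ℕ) * r := le_of_eq (by push_cast; rw [hR]; ring)
  have hJsq : ((2 ^ (k + 3) : ℕ) : ℝ) ^ 2 = 2 ^ (2 * k + 6) := by push_cast; ring
  calc _ ≤ 2 * (1 + 2 ^ (2 * k + 6)) * #(h.ball x (2 * R)) *
        (Cw * (2 * r) ^ 2 * (C * N) * E / (N / C ^ (k + 4)) ^ 2) := hJsq ▸
        h.sum_sq_sub_expect_le_of_oscillation_le f hr (by linarith) (by positivity) hJ hball hosc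
    _ ≤ 2 * (1 + 2 ^ (2 * k + 6)) * (C * N) *
        (Cw * (2 * r) ^ 2 * (C * N) * E / (N / C ^ (k + 4)) ^ 2) := by gcongr
    _ = 8 * (1 + 2 ^ (2 * k + 6)) * C ^ (2 * k + 10) * Cw * r ^ 2 * E := by field_simp; ring
    _ ≤ _ := by gcongr; linarith

theorem poincareWith {Cw : ℝ} {k : ℕ} (hC : 0 < C) (hCw : 0 ≤ Cw) (hvol : G.VolumeDoublingWith C)
    (hweak : ∀ f x r, 1 ≤ r →
      h.oscillation f x r ≤ Cw * r ^ 2 * #(h.ball x r) * h.energy f x (2 ^ k * r)) :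
    G.PoincareWith (C ^ (k + 3) + 8 * (1 + 2 ^ (2 * k + 6)) * C ^ (2 * k + 10) * Cw) := by
  refine h.poincareWith_iff.2 fun x R hR f => ?_
  have hE := h.energy_nonneg f x (2 * R)
  rcases le_total R (2 ^ (k + 2)) with hsmall | hlarge
  · have hone : #(h.ball x (1 / 2)) = 1 := by
      refine card_eq_one.2 ⟨x, eq_singleton_iff_unique_mem.2
        ⟨h.mem_ball.2 (by simp), fun y hy => h.connected.dist_eq_zero_iff.1 ?_⟩⟩
      exact Nat.lt_one_iff.1 (by exact_mod_cast (h.mem_ball.1 hy).trans_lt one_half_lt_one)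
    have hcard : (#(h.ball x R) : ℝ) ≤ C ^ (k + 3) := by
      have hle := h.card_ball_le_pow_mul_card_ball hC.le hvol (x := x) (z := x) (R := R)
        one_half_pos (j := k + 3)
          (by rw [G.dist_self, Nat.cast_zero, zero_add]; exact hsmall.trans_eq (by ring))
      rwa [hone, Nat.cast_one, mul_one] at hle
    calc _ ≤ #(h.ball x R) * (R ^ 2 * h.energy f x R) :=
          h.sum_sq_sub_expect_le_card_mul_energy f x R
      _ ≤ C ^ (k + 3) * (R ^ 2 * h.energy f x (2 * R)) := by
          have := h.energy_nonneg f x R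
          have := h.energy_mono f x (show R ≤ 2 * R by linarith)
          gcongr
      _ ≤ _ := by
          rw [← mul_assoc]
          gcongr
          exact le_add_of_nonneg_right (by positivity)
  · refine (h.sum_sq_sub_expect_le_of_oscillation_le_energy f (r := R / 2 ^ (k + 2)) hC hCw hvol
      (hweak f) ((one_le_div (by positivity)).2 hlarge) (by field_simp)).trans ?_
    gcongr
    exact le_add_of_nonneg_left (by positivity)

end FiniteBalls

/-! ### Graphs that look like the integer grid -/

section Grid

/-- The point of the integer grid with the given coordinates. -/
noncomputable def gridPt (i : ℤ × ℤ) : ℂ := ⟨i.1, i.2⟩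

/-- The lower left corner of the unit cell that contains `z`. -/
noncomputable def gridFloor (z : ℂ) : ℤ × ℤ := (⌊z.re⌋, ⌊z.im⌋)

/-- The square of side `2 * n` around `i` in the integer grid. -/
noncomputable def gridBox (i : ℤ × ℤ) (n : ℕ) : Finset (ℤ × ℤ) :=
  Finset.Icc (i.1 - n) (i.1 + n) ×ˢ Finset.Icc (i.2 - n) (i.2 + n)

theorem unitSeparated_gridPt : UnitSeparated gridPt := by
  have hone : ∀ {a b : ℤ}, a ≠ b → (1 : ℝ) ≤ |(a : ℝ) - b| := fun hab => by
    exact_mod_cast Int.one_le_abs (sub_ne_zero.2 hab)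
  intro i j hij
  rw [dist_eq_norm]
  rcases not_and_or.1 (mt Prod.ext_iff.2 hij) with h | h
  · exact (hone h).trans (Complex.abs_re_le_norm (gridPt i - gridPt j))
  · exact (hone h).trans (Complex.abs_im_le_norm (gridPt i - gridPt j))

theorem dist_gridFloor_le (z : ℂ) : dist z (gridPt (gridFloor z)) ≤ 2 := by
  rw [dist_eq_norm]
  refine (Complex.norm_le_abs_re_add_abs_im _).trans ?_
  change |Int.fract z.re| + |Int.fract z.im| ≤ 2
  rw [Int.abs_fract, Int.abs_fract]
  linarith [Int.fract_lt_one z.re, Int.fract_lt_one z.im]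

theorem card_Icc_sub_add (a : ℤ) (n : ℕ) : (Finset.Icc (a - n) (a + n)).card = 2 * n + 1 := by
  rw [Int.card_Icc]
  lia

theorem card_gridBox (i : ℤ × ℤ) (n : ℕ) : (gridBox i n).card = (2 * n + 1) ^ 2 := by
  rw [gridBox, Finset.card_product, card_Icc_sub_add, card_Icc_sub_add, sq]

theorem floor_mem_Icc {s t r : ℝ} (h : |s - t| ≤ r) :
    ⌊s⌋ ∈ Finset.Icc (⌊t⌋ - (⌊r⌋₊ + 1 : ℕ)) (⌊t⌋ + (⌊r⌋₊ + 1 : ℕ)) := by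
  have hst := abs_le.1 h
  have hr := Nat.lt_floor_add_one r
  rw [Finset.mem_Icc, Int.le_floor, ← Int.lt_add_one_iff, Int.floor_lt]
  push_cast
  constructor <;> linarith [Int.floor_le t, Int.lt_floor_add_one t]

theorem gridFloor_mem_gridBox {z w : ℂ} {r : ℝ} (h : dist w z ≤ r) :
    gridFloor w ∈ gridBox (gridFloor z) (⌊r⌋₊ + 1) := by
  rw [dist_eq_norm] at h
  exact Finset.mem_product.2 ⟨floor_mem_Icc ((Complex.abs_re_le_norm (w - z)).trans h),
    floor_mem_Icc ((Complex.abs_im_le_norm (w - z)).trans h)⟩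

open Classical in
theorem sum_comp_gridFloor_le {V : Type*} {c : V → ℂ} (hc : UnitSeparated c) {s : Finset V}
    {B : Finset (ℤ × ℤ)} (hs : ∀ y ∈ s, gridFloor (c y) ∈ B) {g : ℤ × ℤ → ℝ} (hg : ∀ i, 0 ≤ g i) :
    ∑ y ∈ s, g (gridFloor (c y)) ≤ 25 * ∑ i ∈ B, g i := by
  have hfibre : ∀ i, ((s.filter fun y => gridFloor (c y) = i).card : ℝ) ≤ 25 := by
    intro i
    refine (hc.card_le (gridPt i) zero_le_two _ fun y hy => ?_).trans ?_
    · exact (Finset.mem_filter.1 hy).2 ▸ dist_gridFloor_le (c y)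
    · norm_num [Complex.finrank_real_complex]
  rw [← Finset.sum_fiberwise_of_maps_to hs, Finset.mul_sum]
  refine Finset.sum_le_sum fun i _ => ?_
  rw [Finset.sum_congr rfl fun y hy => by rw [(Finset.mem_filter.1 hy).2], Finset.sum_const,
    nsmul_eq_mul]
  exact mul_le_mul_of_nonneg_right (hfibre i) (hg i)

theorem dist_le_mul_natAbs {V : Type*} {G : SimpleGraph V} (hG : G.Connected) {g : ℤ → V} {L : ℕ}
    (hg : ∀ k, G.dist (g k) (g (k + 1)) ≤ L) (s t : ℤ) :
    G.dist (g s) (g t) ≤ L * (s - t).natAbs := by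
  wlog hst : s ≤ t generalizing s t
  · rw [G.dist_comm, ← Int.natAbs_neg, neg_sub]
    exact this t s (le_of_not_ge hst)
  obtain ⟨m, rfl⟩ := Int.le.dest hst
  rw [sub_add_cancel_left, Int.natAbs_neg, Int.natAbs_natCast]
  clear hst
  induction m with
  | zero => simp
  | succ m ih =>
    rw [Nat.cast_add_one, ← add_assoc, mul_add, mul_one]
    exact hG.dist_triangle.trans (add_le_add ih (hg _))

theorem mul_le_two_pow_mul (L : ℕ) {r : ℝ} (hr : 1 ≤ r) :
    (L : ℝ) * (2 * (r + 1) + 2) ≤ 2 ^ (L + 3) * r := by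
  have hL : (L : ℝ) ≤ 2 ^ L := by exact_mod_cast L.lt_two_pow_self.le
  calc (L : ℝ) * (2 * (r + 1) + 2) ≤ 2 ^ L * (8 * r) := by
        gcongr
        linarith
    _ = 2 ^ (L + 3) * r := by ring

end Grid

/-- The vertices of the graph `G` sit at unit separated points `c v` of the plane, and `φ` maps the
integer grid to `G`. Both maps are Lipschitz and, up to bounded errors, inverse to each other. -/
structure GridApprox {V : Type*} (G : SimpleGraph V) (c : V → ℂ) (φ : ℤ × ℤ → V) (K L : ℕ) :
    Prop where
  connected : G.Connected
  separated : UnitSeparated c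
  lipschitz : ∀ v w, dist (c v) (c w) ≤ G.dist v w
  one_le : 1 ≤ L
  dist_gridPt : ∀ i, dist (c (φ i)) (gridPt i) ≤ K
  dist_right : ∀ i : ℤ × ℤ, G.dist (φ i) (φ (i.1 + 1, i.2)) ≤ L
  dist_up : ∀ i : ℤ × ℤ, G.dist (φ i) (φ (i.1, i.2 + 1)) ≤ L
  dist_floor : ∀ v, G.dist v (φ (gridFloor (c v))) ≤ L

namespace GridApprox

open Finset

variable {V : Type*} {G : SimpleGraph V} {c : V → ℂ} {φ : ℤ × ℤ → V} {K L : ℕ}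

/-- The doubling constant provided by `GridApprox.volumeDoublingWith`. -/
noncomputable def doublingConst (K L : ℕ) : ℝ := 16 * (4 * L * (2 * K + 1)) ^ 2

/-- The constant of the weak Poincaré inequality `GridApprox.oscillation_le`. -/
noncomputable def oscillationConst (K L : ℕ) : ℝ :=
  6 * L * (2 * L + 1) ^ 2 +
    3 * 25 ^ 2 * 4 * 5 ^ 4 * (L * (2 * (K + L) + 1) ^ 2) * (4 * L * (2 * K + 1)) ^ 2

/-- The Poincaré constant provided by `GridApprox.poincareWith`. -/
noncomputable def poincareConst (K L : ℕ) : ℝ :=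
  doublingConst K L ^ (L + 6) + 8 * (1 + 2 ^ (2 * (L + 3) + 6)) *
    doublingConst K L ^ (2 * (L + 3) + 10) * oscillationConst K L

theorem doublingConst_pos (hL : 1 ≤ L) : 0 < doublingConst K L := by
  rw [doublingConst]
  positivity

theorem oscillationConst_nonneg (K L : ℕ) : 0 ≤ oscillationConst K L := by
  rw [oscillationConst]
  positivity

theorem poincareConst_pos (hL : 1 ≤ L) : 0 < poincareConst K L :=
  add_pos_of_pos_of_nonneg (pow_pos (doublingConst_pos hL) _)
    (mul_nonneg (mul_nonneg (by positivity) (pow_pos (doublingConst_pos hL) _).le)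
      (oscillationConst_nonneg K L))

theorem one_le_cast (h : GridApprox G c φ K L) : (1 : ℝ) ≤ L := by exact_mod_cast h.one_le

theorem finiteBalls (h : GridApprox G c φ K L) : FiniteBalls G where
  connected := h.connected
  finite x R := (h.separated.finite_closedBall (c x) R).subset fun v hv =>
    (h.lipschitz v x).trans hv.2

variable (h : GridApprox G c φ K L) (f : V → ℝ) (x : V) {r R : ℝ}

theorem card_ball_le (hR : 0 ≤ R) : (#(h.finiteBalls.ball x R) : ℝ) ≤ (2 * R + 1) ^ 2 := by
  rw [← Complex.finrank_real_complex]
  exact h.separated.card_le (c x) hR _ fun v hv =>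
    (h.lipschitz v x).trans (h.finiteBalls.mem_ball.1 hv)

theorem dist_le_of_mem_gridBox (h : GridApprox G c φ K L) {x : V} {n : ℕ} {i : ℤ × ℤ}
    (hi : i ∈ gridBox (gridFloor (c x)) n) : (G.dist (φ i) x : ℝ) ≤ L * (2 * n + 1) := by
  set j := gridFloor (c x)
  have hright := dist_le_mul_natAbs h.connected (fun k => h.dist_right (k, i.2)) i.1 j.1
  have hup := dist_le_mul_natAbs h.connected (fun k => h.dist_up (j.1, k)) i.2 j.2
  have hfloor := h.dist_floor x
  rw [G.dist_comm] at hfloor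
  have htri := h.connected.dist_triangle (u := φ i) (v := φ j) (w := x)
  have htri' := h.connected.dist_triangle (u := φ i) (v := φ (j.1, i.2)) (w := φ j)
  rw [gridBox, mem_product, mem_Icc, mem_Icc] at hi
  have habs : (i.1 - j.1).natAbs + (i.2 - j.2).natAbs + 1 ≤ 2 * n + 1 := by lia
  have hmul := Nat.mul_le_mul_left L habs
  rw [mul_add, mul_add, mul_one] at hmul
  have hle : G.dist (φ i) x ≤ L * (2 * n + 1) := by
    refine le_trans ?_ hmul
    exact htri.trans (add_le_add (htri'.trans (add_le_add hright hup)) hfloor)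
  exact_mod_cast hle

open Classical in
theorem card_filter_le (h : GridApprox G c φ K L) (s : Finset (ℤ × ℤ)) (v : V) :
    (#{i ∈ s | φ i = v} : ℝ) ≤ (2 * K + 1) ^ 2 := by
  rw [← Complex.finrank_real_complex]
  refine unitSeparated_gridPt.card_le (c v) K.cast_nonneg _ fun i hi => ?_
  rw [← (mem_filter.1 hi).2, dist_comm]
  exact h.dist_gridPt i

theorem sq_le_mul_card_ball {m : ℕ} (hm : L * (2 * m + 1) ≤ r) :
    (2 * m + 1) ^ 2 ≤ (2 * K + 1) ^ 2 * (#(h.finiteBalls.ball x r) : ℝ) := by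
  classical
  have hmaps : ∀ i ∈ gridBox (gridFloor (c x)) m, φ i ∈ h.finiteBalls.ball x r := fun i hi =>
    h.finiteBalls.mem_ball.2 ((h.dist_le_of_mem_gridBox hi).trans hm)
  have hcard : #(gridBox (gridFloor (c x)) m) ≤ (2 * K + 1) ^ 2 * #(h.finiteBalls.ball x r) :=
    card_le_mul_card_image_of_maps_to hmaps _ fun v _ => by exact_mod_cast h.card_filter_le _ v
  rw [card_gridBox] at hcard
  exact_mod_cast hcard

theorem add_one_sq_le_mul_card_ball (hr : 0 ≤ r) :
    (r + 1) ^ 2 ≤ (4 * L * (2 * K + 1)) ^ 2 * #(h.finiteBalls.ball x r) := by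
  have hL := h.one_le_cast
  have hball : (1 : ℝ) ≤ #(h.finiteBalls.ball x r) := by
    exact_mod_cast (h.finiteBalls.ball_nonempty x hr).card_pos
  suffices hm : ∃ m : ℕ, r + 1 ≤ 4 * L * (2 * m + 1) ∧
      (2 * m + 1) ^ 2 ≤ (2 * K + 1) ^ 2 * (#(h.finiteBalls.ball x r) : ℝ) by
    obtain ⟨m, hrm, hm⟩ := hm
    have hsq : (r + 1) ^ 2 ≤ (4 * L * (2 * m + 1)) ^ 2 := by gcongr
    nlinarith [mul_le_mul_of_nonneg_left hm (sq_nonneg (4 * L : ℝ))]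
  rcases lt_or_ge r L with hlt | hge
  · refine ⟨0, by norm_num; linarith, ?_⟩
    have hK : (1 : ℝ) ≤ (2 * K + 1) ^ 2 := one_le_pow₀ (by linarith [K.cast_nonneg (α := ℝ)])
    simpa using one_le_mul_of_one_le_of_one_le hK hball
  · have hrL : 1 ≤ r / L := (one_le_div (by linarith)).2 hge
    have hfloor := Nat.floor_le (show 0 ≤ (r / L - 1) / 2 by linarith)
    have hlt := Nat.lt_floor_add_one ((r / L - 1) / 2)
    refine ⟨⌊(r / L - 1) / 2⌋₊, ?_, h.sq_le_mul_card_ball x ?_⟩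
    · have : r / L < 3 * (2 * ⌊(r / L - 1) / 2⌋₊ + 1) := by linarith
      rw [div_lt_iff₀ (by linarith)] at this
      nlinarith
    · rw [← le_div_iff₀' (by linarith)]
      linarith

theorem volumeDoublingWith (h : GridApprox G c φ K L) :
    G.VolumeDoublingWith (doublingConst K L) := by
  intro x R hR
  refine ⟨h.finiteBalls.finite _ _, ?_⟩
  rw [h.finiteBalls.ncard_metricBall, h.finiteBalls.ncard_metricBall]
  calc (#(h.finiteBalls.ball x (2 * R)) : ℝ) ≤ (2 * (2 * R) + 1) ^ 2 :=
        h.card_ball_le x (by positivity)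
    _ ≤ (4 * (R + 1)) ^ 2 := by gcongr; linarith
    _ = 16 * (R + 1) ^ 2 := by ring
    _ ≤ _ := by
        rw [doublingConst, mul_assoc]
        gcongr
        exact h.add_one_sq_le_mul_card_ball x hR.le

theorem sum_sq_sub_gridFloor_le (r : ℝ) :
    ∑ y ∈ h.finiteBalls.ball x r, (f y - f (φ (gridFloor (c y)))) ^ 2 ≤
      L * (2 * L + 1) ^ 2 * h.finiteBalls.energy f x (r + L) := by
  classical
  refine (sum_le_sum fun y _ => h.finiteBalls.sq_sub_le_mul_energy f (h.dist_floor y)).trans ?_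
  rw [← mul_sum, mul_assoc]
  refine mul_le_mul_of_nonneg_left (h.finiteBalls.sum_energy_le f _ _ ?_ fun u => ?_)
    L.cast_nonneg
  · exact fun y hy => by linarith [h.finiteBalls.mem_ball.1 hy]
  · rw [← Complex.finrank_real_complex]
    refine h.separated.card_le (c u) L.cast_nonneg _ fun y hy => ?_
    rw [dist_comm]
    exact (h.lipschitz u y).trans (mem_filter.1 hy).2

theorem sum_gridBox_step_le {e : ℤ × ℤ → ℤ × ℤ} (he : ∀ i, G.dist (φ i) (φ (e i)) ≤ L) (n : ℕ) :
    ∑ i ∈ gridBox (gridFloor (c x)) n, (f (φ (e i)) - f (φ i)) ^ 2 ≤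
      L * (2 * (K + L) + 1) ^ 2 * h.finiteBalls.energy f x (L * (2 * n + 2)) := by
  classical
  simp only [sub_sq_comm (f (φ (e _)))]
  refine (sum_le_sum fun i _ => h.finiteBalls.sq_sub_le_mul_energy f (he i)).trans ?_
  rw [← mul_sum, mul_assoc]
  refine mul_le_mul_of_nonneg_left (h.finiteBalls.sum_energy_le f _ φ ?_ fun u => ?_)
    L.cast_nonneg
  · exact fun i hi => by linarith [h.dist_le_of_mem_gridBox hi]
  · rw [← Complex.finrank_real_complex]
    refine unitSeparated_gridPt.card_le (c u) (by positivity) _ fun i hi => ?_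
    have hu := (h.lipschitz u (φ i)).trans (mem_filter.1 hi).2
    linarith [dist_triangle (gridPt i) (c (φ i)) (c u), h.dist_gridPt i,
      dist_comm (gridPt i) (c (φ i)), dist_comm (c u) (c (φ i))]

theorem sum_gridBox_sq_sub_le (n : ℕ) :
    ∑ i ∈ gridBox (gridFloor (c x)) n, ∑ j ∈ gridBox (gridFloor (c x)) n,
      (f (φ i) - f (φ j)) ^ 2 ≤ 4 * (2 * n + 1) ^ 4 * (L * (2 * (K + L) + 1) ^ 2) *
        h.finiteBalls.energy f x (L * (2 * n + 2)) := by
  have hgrid := sum_sq_sub_le_grid (fun i => f (φ i)) (a := (gridFloor (c x)).1 - n)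
    (b := (gridFloor (c x)).1 + n) (a' := (gridFloor (c x)).2 - n)
    (b' := (gridFloor (c x)).2 + n) rfl rfl
  rw [card_Icc_sub_add, card_Icc_sub_add, ← gridBox] at hgrid
  have hright := h.sum_gridBox_step_le f x h.dist_right n
  have hup := h.sum_gridBox_step_le f x h.dist_up n
  push_cast at hgrid
  calc _ ≤ _ := hgrid
    _ ≤ _ := add_le_add (mul_le_mul_of_nonneg_left hright (by positivity))
      (mul_le_mul_of_nonneg_left hup (by positivity))
    _ = _ := by ring

theorem sum_sum_comp_gridFloor_le (F : ℤ × ℤ → ℝ) (r : ℝ) :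
    ∑ y ∈ h.finiteBalls.ball x r, ∑ z ∈ h.finiteBalls.ball x r,
      (F (gridFloor (c y)) - F (gridFloor (c z))) ^ 2 ≤
    25 ^ 2 * ∑ i ∈ gridBox (gridFloor (c x)) (⌊r⌋₊ + 1),
      ∑ j ∈ gridBox (gridFloor (c x)) (⌊r⌋₊ + 1), (F i - F j) ^ 2 := by
  have hfloor : ∀ y ∈ h.finiteBalls.ball x r,
      gridFloor (c y) ∈ gridBox (gridFloor (c x)) (⌊r⌋₊ + 1) := fun y hy =>
    gridFloor_mem_gridBox ((h.lipschitz y x).trans (h.finiteBalls.mem_ball.1 hy))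
  calc _ ≤ ∑ y ∈ h.finiteBalls.ball x r, 25 * ∑ j ∈ gridBox (gridFloor (c x)) (⌊r⌋₊ + 1),
        (F (gridFloor (c y)) - F j) ^ 2 := sum_le_sum fun y _ =>
        sum_comp_gridFloor_le h.separated hfloor (g := fun j => (F (gridFloor (c y)) - F j) ^ 2)
          fun _ => sq_nonneg _
    _ ≤ 25 * (25 * ∑ i ∈ gridBox (gridFloor (c x)) (⌊r⌋₊ + 1),
          ∑ j ∈ gridBox (gridFloor (c x)) (⌊r⌋₊ + 1), (F i - F j) ^ 2) := by
        rw [← mul_sum]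
        gcongr
        exact sum_comp_gridFloor_le h.separated hfloor
          (g := fun i => ∑ j ∈ gridBox (gridFloor (c x)) (⌊r⌋₊ + 1), (F i - F j) ^ 2)
          fun _ => sum_nonneg fun _ _ => sq_nonneg _
    _ = _ := by ring

theorem sum_sum_sq_sub_gridFloor_le (hr : 1 ≤ r) :
    ∑ y ∈ h.finiteBalls.ball x r, ∑ z ∈ h.finiteBalls.ball x r,
      (f (φ (gridFloor (c y))) - f (φ (gridFloor (c z)))) ^ 2 ≤
    25 ^ 2 * (4 * (5 * r) ^ 4 * (L * (2 * (K + L) + 1) ^ 2) *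
      h.finiteBalls.energy f x (2 ^ (L + 3) * r)) := by
  have hfloor : ((⌊r⌋₊ + 1 : ℕ) : ℝ) ≤ r + 1 := by
    rw [Nat.cast_add_one]
    linarith [Nat.floor_le (show 0 ≤ r by linarith)]
  refine (h.sum_sum_comp_gridFloor_le x (fun i => f (φ i)) r).trans ?_
  gcongr
  refine (h.sum_gridBox_sq_sub_le f x _).trans ?_
  have hE := h.finiteBalls.energy_nonneg f x (L * (2 * (⌊r⌋₊ + 1 : ℕ) + 2))
  gcongr
  · linarith
  · refine h.finiteBalls.energy_mono f x (le_trans ?_ (mul_le_two_pow_mul L hr))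
    gcongr

theorem oscillation_le (hr : 1 ≤ r) :
    h.finiteBalls.oscillation f x r ≤ oscillationConst K L * r ^ 2 * #(h.finiteBalls.ball x r) *
      h.finiteBalls.energy f x (2 ^ (L + 3) * r) := by
  set B := h.finiteBalls.ball x r
  set E := h.finiteBalls.energy f x (2 ^ (L + 3) * r)
  set g : V → ℝ := fun y => f (φ (gridFloor (c y)))
  have hfloor : ∑ y ∈ B, (f y - g y) ^ 2 ≤ L * (2 * L + 1) ^ 2 * E := by
    refine (h.sum_sq_sub_gridFloor_le f x r).trans ?_
    gcongr
    refine h.finiteBalls.energy_mono f x (le_trans ?_ (mul_le_two_pow_mul L hr))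
    nlinarith [L.cast_nonneg (α := ℝ), h.one_le_cast]
  have hgrid := h.sum_sum_sq_sub_gridFloor_le f x hr
  have hball : r ^ 2 ≤ (4 * L * (2 * K + 1)) ^ 2 * #B :=
    le_trans (by gcongr; linarith) (h.add_one_sq_le_mul_card_ball x (by linarith))
  have hE : 0 ≤ E := h.finiteBalls.energy_nonneg _ _ _
  calc h.finiteBalls.oscillation f x r
      ≤ 6 * #B * ∑ y ∈ B, (f y - g y) ^ 2 + 3 * ∑ y ∈ B, ∑ z ∈ B, (g y - g z) ^ 2 :=
        sum_sum_sq_sub_le B f g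
    _ ≤ 6 * #B * (L * (2 * L + 1) ^ 2 * E) +
          3 * (25 ^ 2 * (4 * (5 * r) ^ 4 * (L * (2 * (K + L) + 1) ^ 2) * E)) := by gcongr
    _ = 6 * #B * (L * (2 * L + 1) ^ 2 * E) * 1 +
          3 * (25 ^ 2 * (4 * 5 ^ 4 * (L * (2 * (K + L) + 1) ^ 2) * E)) * r ^ 2 * r ^ 2 := by ring
    _ ≤ 6 * #B * (L * (2 * L + 1) ^ 2 * E) * r ^ 2 +
          3 * (25 ^ 2 * (4 * 5 ^ 4 * (L * (2 * (K + L) + 1) ^ 2) * E)) * r ^ 2 *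
            ((4 * L * (2 * K + 1)) ^ 2 * #B) := by
        gcongr
        exact one_le_pow₀ hr
    _ = _ := by
        rw [oscillationConst]
        ring

theorem poincareWith (h : GridApprox G c φ K L) : G.PoincareWith (poincareConst K L) :=
  h.finiteBalls.poincareWith (doublingConst_pos h.one_le) (oscillationConst_nonneg K L)
    h.volumeDoublingWith fun f x _ hr => h.oscillation_le f x hr

end GridApprox

namespace PennyConfiguration

variable {V : Type*} {P : PennyConfiguration V} {D : ℕ}

theorem FaceBound.exists_gridApprox [Infinite V] (hD : P.FaceBound D)
    (hconn : P.graph.Connected) :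
    ∃ φ, GridApprox P.graph P.pos φ (18 * D + 2) ((36 * D + 9) ^ 2 * (9 * D + 1)) := by
  choose φ hφ using fun i => P.around_nonempty hconn (gridPt i)
  refine ⟨φ, hconn, P.unitSeparated_pos, fun v w => ?_, Nat.one_le_iff_ne_zero.2 (by positivity),
    fun i => ?_, fun i => ?_, fun i => ?_, fun v => ?_⟩
  · rw [dist_eq_norm]
    exact P.norm_pos_sub_le_dist hconn v w
  · rw [dist_eq_norm]
    exact_mod_cast hD.norm_sub_le_of_mem_around hconn (hφ i)
  · refine hD.dist_le_of_near hconn ?_ (hφ i) (hφ _)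
    rw [show gridPt i - gridPt (i.1 + 1, i.2) = -1 from Complex.ext (by simp [gridPt])
      (by simp [gridPt])]
    norm_num
  · refine hD.dist_le_of_near hconn ?_ (hφ i) (hφ _)
    rw [show gridPt i - gridPt (i.1, i.2 + 1) = -Complex.I from Complex.ext (by simp [gridPt])
      (by simp [gridPt])]
    norm_num
  · refine hD.dist_le_of_near (p := P.pos v) hconn ?_ (Or.inr (by simp)) (hφ _)
    rw [← dist_eq_norm]
    exact dist_gridFloor_le (P.pos v)

end PennyConfiguration

theorem theorem1p2 (D : ℕ) :
    ∃ C₁ C₂ : ℝ, 0 < C₁ ∧ 0 < C₂ ∧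
      ∀ (V : Type*) [Infinite V] (P : PennyConfiguration V),
        P.graph.Connected →
        (∀ σ ∈ P.faces, P.facialDegree σ ≤ (D : ℕ∞)) →
        P.graph.VolumeDoublingWith C₁ ∧ P.graph.PoincareWith C₂ := by
  have hL : 1 ≤ (36 * D + 9) ^ 2 * (9 * D + 1) := Nat.one_le_iff_ne_zero.2 (by positivity)
  refine ⟨GridApprox.doublingConst (18 * D + 2) _, GridApprox.poincareConst (18 * D + 2) _,
    GridApprox.doublingConst_pos hL, GridApprox.poincareConst_pos hL, fun V _ P hconn hdeg => ?_⟩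
  obtain ⟨φ, hφ⟩ := (P.faceBound_of_facialDegree_le hconn hdeg).exists_gridApprox hconn
  exact ⟨hφ.volumeDoublingWith, hφ.poincareWith⟩
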